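/- Let $k$ be an algebraically closed field of characteristic $0$ and let $n\ge 1$. Let $\varepsilon_{ij}\in k$ ($1\le i,j\le n$) satisfy $\varepsilon_{ii}=1$, $\varepsilon_{ij}\varepsilon_{ji}=1$, and $\varepsilon_{ij}\in\{1,-1\}$ for $i\ne j$. Let $$S=k\langle x_1,\dots,x_n\rangle/(x_ix_j-\varepsilon_{ij}x_jx_i)_{1\le i,j\le n},\qquad \deg x_i=1,$$ let $f=x_1^2+\cdots+x_n^2\in S_2$, and let $A=S/(f)$. A *point module* over $S$ is a graded right $S$-module $M$ which is cyclic, generated in degree $0$, and satisfies $\dim_k M_d=1$ for all $d\ge 0$. It determines the point $p_M=\mathcal V(g\in S_1 : M_0g=0)\in\mathbb P(S_1^*)=\mathbb P^{n-1}$. Let $E=\{p_M : M \text{ a point module over } S\}\subseteq\mathbb P^{n-1}$ (the point scheme of $S$). For $i<j$ let $\mathbb P(i,j)=\bigcap_{l\ne i,j}\mathcal V(x_l)\subseteq\mathbb P^{n-1}$. For a quadratic algebra $B=T(V)/(R)$ with $R\subseteq V\otimes V$, let $B^!=T(V^*)/(R^\perp)$ be its quadratic dual. There is a central regular element $w\in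 A^!_2$ which generates the kernel of the surjection $A^!\to S^!$ dual to $S\to A$, so that $A^!/(w)\cong S^!$. For any such $w$ put $C(A)=A^![w^{-1}]_0$, the degree zero part of the localization. Then, with isomorphisms of $k$-algebras: 1. If $E=\mathbb P^{n-1}$, then $C(A)$ is isomorphic to $$C_+=k\langle t_1,\dots,t_{n-1}\rangle/(t_it_j+t_jt_i\ (i\ne j),\ t_i^2-1).$$ 2. If $n\ge 2$, then $E=\bigcup_{1\le i<j\le n}\mathbb P(i,j)$ if and only if $C(A)$ is isomorphic to $$C_-=k\langle t_1,\dots,t_{n-1}\rangle/(t_it_j-t_jt_i\ (i\ne j),\ t_i^2-1).$$ -/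

import Mathlib

open scoped LinearAlgebra.Projectivization

universe u

noncomputable section

/-! ### Quadratic algebras and their quadratic duals -/

section Quadratic

variable {k : Type u} [Field k] {n : ℕ}

/-- The element `∑ c i j x_i x_j` of degree two of the free algebra `k⟨x_1, …, x_n⟩`.  The matrix
`c` stands for the tensor `∑ c i j x_i ⊗ x_j` in `V ⊗ V`, where `V` has the basis
`x_1, …, x_n`. -/
def quadForm (c : Fin n → Fin n → k) : FreeAlgebra k (Fin n) :=
  ∑ i, ∑ j, c i j • (FreeAlgebra.ι k i * FreeAlgebra.ι k j)

/-- The quadratic algebra `T(V)/(R) = k⟨x_1, …, x_n⟩/(R)` with space of relations `R ⊆ V ⊗ V`. -/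
abbrev QuadAlg (R : Submodule k (Fin n → Fin n → k)) : Type u :=
  RingQuot fun a b : FreeAlgebra k (Fin n) => ∃ c ∈ R, a = quadForm c ∧ b = 0

/-- The quotient map `k⟨x_1, …, x_n⟩ → k⟨x_1, …, x_n⟩/(R)`. -/
def QuadAlg.mk (R : Submodule k (Fin n → Fin n → k)) : FreeAlgebra k (Fin n) →ₐ[k] QuadAlg R :=
  RingQuot.mkAlgHom k _

/-- The generator `x_i` of the quadratic algebra. -/
def QuadAlg.gen (R : Submodule k (Fin n → Fin n → k)) (i : Fin n) : QuadAlg R :=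
  QuadAlg.mk R (FreeAlgebra.ι k i)

/-- The homogeneous component of degree `d` (where `deg x_i = 1`): the span of the words of length
`d` in the generators. -/
def QuadAlg.deg (R : Submodule k (Fin n → Fin n → k)) (d : ℕ) : Submodule k (QuadAlg R) :=
  Submodule.span k (Set.range (QuadAlg.gen R)) ^ d

/-- For `R ⊆ R'`, the canonical surjection `T(V)/(R) → T(V)/(R')`, `x_i ↦ x_i`. -/
def QuadAlg.proj {R R' : Submodule k (Fin n → Fin n → k)} (h : R ≤ R') :
    QuadAlg R →ₐ[k] QuadAlg R' :=
  RingQuot.liftAlgHom k ⟨QuadAlg.mk R', by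
    rintro _ _ ⟨c, hc, rfl, rfl⟩
    rw [map_zero, QuadAlg.mk, RingQuot.mkAlgHom_rel k ⟨c, h hc, rfl, rfl⟩, map_zero]⟩

/-- The annihilator `R^⊥ ⊆ V* ⊗ V*` of `R ⊆ V ⊗ V`, in the dual basis.  The quadratic dual of
`T(V)/(R)` is `T(V*)/(R^⊥)`, that is, `QuadAlg (quadPerp R)`. -/
def quadPerp (R : Submodule k (Fin n → Fin n → k)) : Submodule k (Fin n → Fin n → k) where
  carrier := {d | ∀ c ∈ R, ∑ i, ∑ j, d i j * c i j = 0}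
  zero_mem' := by simp
  add_mem' := by
    intro a b ha hb c hc
    simp [add_mul, Finset.sum_add_distrib, ha c hc, hb c hc]
  smul_mem' := by
    intro r a ha c hc
    simp [mul_assoc, ← Finset.mul_sum, ha c hc]

theorem quadPerp_anti {R R' : Submodule k (Fin n → Fin n → k)} (h : R ≤ R') :
    quadPerp R' ≤ quadPerp R :=
  fun _ hd c hc => hd c (h hc)

end Quadratic

/-! ### Point modules and the point scheme -/

section Points

variable {k : Type u} [Field k] {n : ℕ}

/-- `M`, with grading `ℳ`, is a point module over `T(V)/(R)`: a graded right module which is cyclic,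
generated in degree `0`, and has Hilbert series `(1 - t)⁻¹`. -/
structure IsPointModule (R : Submodule k (Fin n → Fin n → k)) (M : Type u) [AddCommGroup M]
    [Module k M] [Module (QuadAlg R)ᵐᵒᵖ M] (ℳ : ℕ → Submodule k M) : Prop where
  isInternal : DirectSum.IsInternal ℳ
  smul_mem : ∀ (d e : ℕ), ∀ s ∈ QuadAlg.deg R d, ∀ m ∈ ℳ e, MulOpposite.op s • m ∈ ℳ (e + d)
  cyclic : ∃ m ∈ ℳ 0, Submodule.span (QuadAlg R)ᵐᵒᵖ {m} = ⊤
  hilbert : ∀ d, Module.finrank k (ℳ d) = 1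

/-- `p` lies on the zero locus `𝒱(g : g ∈ S_1, M_0 g = 0)` in `ℙ(S_1^*) = ℙ^{n-1}`, where
`S = T(V)/(R)`.  If `M = S/(g_1 S + ⋯ + g_{n-1} S)` is a point module with linearly independent
`g_i ∈ S_1`, then the linear forms with `M_0 g = 0` are the combinations of `g_1, …, g_{n-1}`, and
the zero locus is the single point `p_M = 𝒱(g_1, …, g_{n-1})`. -/
def IsPointOf (R : Submodule k (Fin n → Fin n → k)) (M : Type u) [AddCommGroup M]
    [Module k M] [Module (QuadAlg R)ᵐᵒᵖ M] (ℳ : ℕ → Submodule k M) (p : ℙ k (Fin n → k)) : Prop :=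
  ∀ g : Fin n → k, (∀ m ∈ ℳ 0, MulOpposite.op (∑ i, g i • QuadAlg.gen R i) • m = 0) →
    ∑ i, g i * p.rep i = 0

/-- The point scheme `E = {p_M ∈ ℙ^{n-1} | M is a point module}` of `T(V)/(R)`.  A point module has
countable dimension over `k`, so that all of them, up to isomorphism, live in the universe
of `k`. -/
def pointScheme (R : Submodule k (Fin n → Fin n → k)) : Set (ℙ k (Fin n → k)) :=
  {p | ∃ (M : Type u) (_ : AddCommGroup M) (_ : Module k M) (_ : Module (QuadAlg R)ᵐᵒᵖ M)
    (_ : IsScalarTower k (QuadAlg R)ᵐᵒᵖ M) (ℳ : ℕ → Submodule k M),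
    IsPointModule R M ℳ ∧ IsPointOf R M ℳ p}

/-- The linear subspace `ℙ(i_1, …, i_s) = ⋂_{j ≠ i_1, …, i_s} 𝒱(x_j)` of `ℙ^{n-1}`, where
`I = {i_1, …, i_s}`. -/
def linSubspace (k : Type u) [Field k] {n : ℕ} (I : Set (Fin n)) : Set (ℙ k (Fin n → k)) :=
  {p | ∀ j, j ∉ I → p.rep j = 0}

end Points

/-! ### Inverting a central element of degree two -/

section CentralLocalization

variable {k : Type u} [Field k] {B : Type u} [Ring B] [Algebra k B]

theorem center_commute (w : Subalgebra.center k B) (r : B) : (w : B) * r = r * (w : B) :=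
  (Subalgebra.mem_center_iff.1 w.2 r).symm

theorem center_powers_commute (w : Subalgebra.center k B) (s : Submonoid.powers (w : B)) (r : B) :
    (s : B) * r = r * (s : B) := by
  obtain ⟨_, m, rfl⟩ := s
  exact (show Commute (w : B) r from center_commute w r).pow_left m

/-- The powers of a central element form an Ore set, so that `B[w⁻¹]` is Mathlib's localization
`OreLocalization (Submonoid.powers w) B`. -/
instance oreSetPowersCenter (w : Subalgebra.center k B) :
    OreLocalization.OreSet (Submonoid.powers (w : B)) where
  ore_right_cancel r₁ r₂ s h := ⟨s, by
    rw [center_powers_commute w s r₁, center_powers_commute w s r₂, h]⟩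
  oreNum r _ := r
  oreDenom _ s := s
  ore_eq r s := center_powers_commute w s r

/-- `w ^ m` as an element of the multiplicative set of powers of `w`. -/
def powElt (w : Subalgebra.center k B) (m : ℕ) : Submonoid.powers (w : B) :=
  ⟨(w : B) ^ m, m, rfl⟩

open OreLocalization in
/-- The degree zero part `B[w⁻¹]_0 = {a w^{-m} | a ∈ B_{2m}}` of `B[w⁻¹]`, for a graded algebra `B`
with components `B_d = V ^ d` and a central element `w` of degree two. -/
def locDegZero (V : Submodule k B) (w : Subalgebra.center k B) (hw : (w : B) ∈ V ^ 2) :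
    Subalgebra k (OreLocalization (Submonoid.powers (w : B)) B) where
  carrier := {b | ∃ (m : ℕ) (a : B), a ∈ V ^ (2 * m) ∧ b = a /ₒ powElt w m}
  mul_mem' := by
    rintro _ _ ⟨m, a, ha, rfl⟩ ⟨l, b, hb, rfl⟩
    refine ⟨l + m, a * b, ?_, ?_⟩
    · rw [show 2 * (l + m) = 2 * m + 2 * l by ring, pow_add]
      exact Submodule.mul_mem_mul ha hb
    · rw [oreDiv_mul_char a b _ _ a (powElt w l) (center_powers_commute w _ a)]
      congr 1
      exact Subtype.ext (pow_add _ _ _).symm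
  add_mem' := by
    rintro _ _ ⟨m, a, ha, rfl⟩ ⟨l, b, hb, rfl⟩
    have hp : ∀ j, (w : B) ^ j ∈ V ^ (2 * j) := fun j => by
      rw [pow_mul]
      exact Submodule.pow_mem_pow _ hw j
    refine ⟨l + m, (w : B) ^ l * a + (w : B) ^ m * b, ?_, ?_⟩
    · refine Submodule.add_mem _ ?_ ?_
      · rw [show 2 * (l + m) = 2 * l + 2 * m by ring, pow_add]
        exact Submodule.mul_mem_mul (hp l) ha
      · rw [show 2 * (l + m) = 2 * m + 2 * l by ring, pow_add]
        exact Submodule.mul_mem_mul (hp m) hb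
    · rw [oreDiv_add_char _ _ ((w : B) ^ m) (powElt w l)
        (center_powers_commute w _ _)]
      congr 1
      exact Subtype.ext (pow_add _ _ _).symm
  algebraMap_mem' r := by
    refine ⟨0, algebraMap k B r, ?_, ?_⟩
    · rw [mul_zero, pow_zero]
      exact Submodule.algebraMap_mem r
    · rw [show powElt w 0 = 1 from Subtype.ext (pow_zero _)]
      rfl

end CentralLocalization

/-! ### Skew polynomial algebras, the quadric hypersurface, and the algebra `C(A)` -/

section Skew

variable {k : Type u} [Field k] {n : ℕ}

/-- The parameters of a graded `(±1)`-skew polynomial algebra. -/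
structure IsSignMatrix (ε : Fin n → Fin n → k) : Prop where
  diag : ∀ i, ε i i = 1
  mul_swap : ∀ i j, ε i j * ε j i = 1
  sign : ∀ i j, i ≠ j → ε i j = 1 ∨ ε i j = -1

/-- The tensor `x_i ⊗ x_j`. -/
def unitTensor (k : Type u) [Field k] {n : ℕ} (i j : Fin n) : Fin n → Fin n → k :=
  Pi.single i (Pi.single j 1)

/-- The relations `x_i x_j - ε i j x_j x_i` of `S`; thus
`S = k⟨x_1, …, x_n⟩/(x_i x_j - ε i j x_j x_i)` is `QuadAlg (relS ε)`. -/
def relS (ε : Fin n → Fin n → k) : Submodule k (Fin n → Fin n → k) :=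
  Submodule.span k {c | ∃ i j, c = unitTensor k i j - ε i j • unitTensor k j i}

/-- The relations of `A = S/(f)`, where `f = x_1² + ⋯ + x_n²`: those of `S`, and `f`. -/
def relA (ε : Fin n → Fin n → k) : Submodule k (Fin n → Fin n → k) :=
  relS ε ⊔ Submodule.span k {∑ i, unitTensor k i i}

/-- The quadratic dual `S^!`. -/
abbrev SDual (ε : Fin n → Fin n → k) : Type u := QuadAlg (quadPerp (relS ε))

/-- The quadratic dual `A^!` of `A = S/(f)`. -/
abbrev ADual (ε : Fin n → Fin n → k) : Type u := QuadAlg (quadPerp (relA ε))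

/-- The surjection `A^! → S^!` dual to `S → A`. -/
def dualProj (ε : Fin n → Fin n → k) : ADual ε →ₐ[k] SDual ε :=
  QuadAlg.proj (quadPerp_anti le_sup_left)

/-- `w` is a central regular element of `A^!`, of degree two, and `A^!/(w) = S^!`: the kernel of
`A^! → S^!` is the ideal generated by `w` (as `w` is central, left and two-sided ideals generated
by `w` agree).  Centrality is contained in the type of `w`. -/
structure IsHypersurfaceElement (ε : Fin n → Fin n → k) (w : Subalgebra.center k (ADual ε)) :
    Prop where
  mem_deg : (w : ADual ε) ∈ QuadAlg.deg (quadPerp (relA ε)) 2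
  regular : IsRegular (w : ADual ε)
  ker_eq : RingHom.ker (dualProj ε) = Ideal.span {(w : ADual ε)}

/-- The algebra `C(A) = A^![w⁻¹]_0`. -/
abbrev CAlg (ε : Fin n → Fin n → k) (w : Subalgebra.center k (ADual ε))
    (hw : IsHypersurfaceElement ε w) : Type u :=
  locDegZero (Submodule.span k (Set.range (QuadAlg.gen (quadPerp (relA ε))))) w hw.mem_deg

/-- The defining relations of `k⟨t_1, …, t_m⟩/(t_i t_j - s t_j t_i, t_i² - 1)_{i ≠ j}`. -/
inductive CliffordRel {k : Type u} [Field k] (s : k) (m : ℕ) :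
    FreeAlgebra k (Fin m) → FreeAlgebra k (Fin m) → Prop
  | swap (i j : Fin m) (h : i ≠ j) :
      CliffordRel s m (FreeAlgebra.ι k i * FreeAlgebra.ι k j)
        (s • (FreeAlgebra.ι k j * FreeAlgebra.ι k i))
  | sq (i : Fin m) : CliffordRel s m (FreeAlgebra.ι k i * FreeAlgebra.ι k i) 1

/-- `C₊ = k⟨t_1, …, t_{n-1}⟩/(t_i t_j + t_j t_i, t_i² - 1)_{i ≠ j}`. -/
abbrev CPlus (k : Type u) [Field k] (n : ℕ) : Type u := RingQuot (CliffordRel (-1 : k) (n - 1))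

/-- `C₋ = k⟨t_1, …, t_{n-1}⟩/(t_i t_j - t_j t_i, t_i² - 1)_{i ≠ j}`. -/
abbrev CMinus (k : Type u) [Field k] (n : ℕ) : Type u := RingQuot (CliffordRel (1 : k) (n - 1))

end Skew

end

/-! Both sides of the statement are governed by the triple products ε_ij ε_jl ε_li, which are 1 or
-1.

Point scheme: if x_i, x_j, x_l are all nonzero at a point of E, comparing the actions M_0 → M_1 →
M_2 forces ε_ij ε_jl ε_li = 1 (`sign_mul_sign_mul_sign_of_mem_pointScheme`). Conversely, if ε_ij =
η_i η_j on the support of p with η_i² = 1, a twisted shift on k[t] is a point module at p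
(`mem_pointScheme_of_sign_eq`). So E = ℙ^{n-1} makes every triple product 1, and E is the union of
the lines ℙ(i,j) exactly when the products over distinct triples are all -1.

Dual side: A^! has generators x_i with x_i x_j = -ε_ij x_j x_i for i ≠ j and a common square ω,
which is central and regular and generates the kernel of A^! → S^!. Degree reasons make every
admissible w a nonzero multiple of ω. Hence C(A) is generated by the elements x_i x_0 / w, i ≠ 0;
suitably rescaled they square to 1 and satisfy t_i t_j = s t_j t_i with s = -(ε_ij ε_0i ε_0j).
Triple products 1 give C₊, and -1 give C₋ (`ADual.nonempty_equiv_clifford`). Conversely C₋ is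
commutative, which forces s = 1 for all triples through 0 (`ADual.sign_of_commute`), and the other
triples follow by multiplying three of these.

All linear independence (regularity of ω, injectivity of C_± → C(A)) comes from one device:
representations in which x_i acts by a sign-twisted shift of basis vectors indexed by a monoid over
(ℤ/2)^n. -/

noncomputable section

/-! ### Presentations of S, S^! and A^! -/

section QuadraticLemmas

variable {k : Type u} [Field k] {n : ℕ}

theorem map_quadForm {T : Type*} [Ring T] [Algebra k T] (f : FreeAlgebra k (Fin n) →ₐ[k] T)
    (c : Fin n → Fin n → k) :
    f (quadForm c) = ∑ i, ∑ j, c i j • (f (FreeAlgebra.ι k i) * f (FreeAlgebra.ι k j)) := by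
  simp [quadForm]

theorem QuadAlg.sum_gen_mul_gen {R : Submodule k (Fin n → Fin n → k)} {c : Fin n → Fin n → k}
    (hc : c ∈ R) : ∑ i, ∑ j, c i j • (QuadAlg.gen R i * QuadAlg.gen R j) = 0 := by
  have h := map_quadForm (QuadAlg.mk R) c
  rw [QuadAlg.mk, RingQuot.mkAlgHom_rel k ⟨c, hc, rfl, rfl⟩, map_zero] at h
  exact h.symm

/-- The algebra homomorphism out of a quadratic algebra with given values on the generators. -/
def QuadAlg.lift {T : Type*} [Ring T] [Algebra k T] (R : Submodule k (Fin n → Fin n → k))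
    (y : Fin n → T) (hy : ∀ c ∈ R, ∑ i, ∑ j, c i j • (y i * y j) = 0) : QuadAlg R →ₐ[k] T :=
  RingQuot.liftAlgHom k ⟨FreeAlgebra.lift k y, by
    rintro _ _ ⟨c, hc, rfl, rfl⟩
    rw [map_quadForm, map_zero]
    simpa using hy c hc⟩

@[simp]
theorem QuadAlg.lift_gen {T : Type*} [Ring T] [Algebra k T] (R : Submodule k (Fin n → Fin n → k))
    (y : Fin n → T) (hy : ∀ c ∈ R, ∑ i, ∑ j, c i j • (y i * y j) = 0) (i : Fin n) :
    QuadAlg.lift R y hy (QuadAlg.gen R i) = y i := by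
  simp [QuadAlg.lift, QuadAlg.gen, QuadAlg.mk]

theorem QuadAlg.adjoin_gen (R : Submodule k (Fin n → Fin n → k)) :
    Algebra.adjoin k (Set.range (QuadAlg.gen R)) = ⊤ := by
  have h : Set.range (QuadAlg.gen R) = QuadAlg.mk R '' Set.range (FreeAlgebra.ι k) := by
    rw [← Set.range_comp]; rfl
  rw [h, ← AlgHom.map_adjoin, FreeAlgebra.adjoin_range_ι, Algebra.map_top, AlgHom.range_eq_top]
  exact RingQuot.mkAlgHom_surjective k _

theorem QuadAlg.algHom_ext {T : Type*} [Ring T] [Algebra k T]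
    {R : Submodule k (Fin n → Fin n → k)} {f g : QuadAlg R →ₐ[k] T}
    (h : ∀ i, f (QuadAlg.gen R i) = g (QuadAlg.gen R i)) : f = g := by
  apply AlgHom.ext_of_adjoin_eq_top (QuadAlg.adjoin_gen R)
  rintro _ ⟨i, rfl⟩
  exact h i

@[simp]
theorem QuadAlg.proj_gen {R R' : Submodule k (Fin n → Fin n → k)} (h : R ≤ R') (i : Fin n) :
    QuadAlg.proj h (QuadAlg.gen R i) = QuadAlg.gen R' i := by
  simp only [QuadAlg.proj, QuadAlg.gen, QuadAlg.mk]
  exact RingQuot.liftAlgHom_mkAlgHom_apply ..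

theorem sum_unitTensor {M : Type*} [AddCommGroup M] [Module k M] (i j : Fin n)
    (y : Fin n → Fin n → M) : ∑ a, ∑ b, unitTensor k i j a b • y a b = y i j := by
  rw [Finset.sum_eq_single i, Finset.sum_eq_single j] <;>
    simp +contextual [unitTensor, Pi.single_apply]

theorem sum_mul_unitTensor (i j : Fin n) (y : Fin n → Fin n → k) :
    ∑ a, ∑ b, y a b * unitTensor k i j a b = y i j := by
  simpa [mul_comm] using sum_unitTensor (k := k) i j y

theorem quadPerp_sup (R R' : Submodule k (Fin n → Fin n → k)) :
    quadPerp (R ⊔ R') = quadPerp R ⊓ quadPerp R' := by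
  refine le_antisymm (le_inf (quadPerp_anti le_sup_left) (quadPerp_anti le_sup_right)) ?_
  rintro d ⟨h, h'⟩ c hc
  obtain ⟨a, ha, b, hb, rfl⟩ := Submodule.mem_sup.1 hc
  simp [mul_add, Finset.sum_add_distrib, h a ha, h' b hb]

theorem mem_quadPerp_span {s : Set (Fin n → Fin n → k)} {d : Fin n → Fin n → k} :
    d ∈ quadPerp (Submodule.span k s) ↔ ∀ c ∈ s, ∑ i, ∑ j, d i j * c i j = 0 := by
  refine ⟨fun h c hc => h c (Submodule.subset_span hc), fun h c hc => ?_⟩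
  induction hc using Submodule.span_induction with
  | mem c hc => exact h c hc
  | zero => simp
  | add a b _ _ ha hb => simp [mul_add, Finset.sum_add_distrib, ha, hb]
  | smul r a _ ha => simp [mul_left_comm, ← Finset.mul_sum, ha]

theorem mem_quadPerp_relS {ε d : Fin n → Fin n → k} :
    d ∈ quadPerp (relS ε) ↔ ∀ i j, d i j = ε i j * d j i := by
  have key : ∀ i j, ∑ a, ∑ b, d a b * (unitTensor k i j - ε i j • unitTensor k j i) a b
      = d i j - ε i j * d j i := by
    intro i j
    simp only [Pi.sub_apply, Pi.smul_apply, smul_eq_mul, mul_sub, Finset.sum_sub_distrib,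
      mul_left_comm _ (ε i j), ← Finset.mul_sum, sum_mul_unitTensor]
  rw [relS, mem_quadPerp_span]
  constructor
  · intro h i j
    rw [← sub_eq_zero, ← key, h _ ⟨i, j, rfl⟩]
  · rintro h _ ⟨i, j, rfl⟩
    rw [key, h i j, sub_self]

/-- The form f contributes only the trace condition, which weakens the relations x_i² = 0 of S^! to
x_i² = x_j² in A^!. -/
theorem mem_quadPerp_relA {ε d : Fin n → Fin n → k} :
    d ∈ quadPerp (relA ε) ↔ (∀ i j, d i j = ε i j * d j i) ∧ ∑ i, d i i = 0 := by
  rw [relA, quadPerp_sup, Submodule.mem_inf, mem_quadPerp_relS, mem_quadPerp_span]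
  have key : ∑ a, ∑ b, d a b * (∑ i, unitTensor k i i) a b = ∑ i, d i i := by
    simp only [Finset.sum_apply, Finset.mul_sum]
    rw [← Finset.sum_congr rfl fun i _ => sum_mul_unitTensor i i d, Finset.sum_comm]
    conv_rhs => rw [Finset.sum_comm]
    rw [Finset.sum_comm]
    refine Finset.sum_congr rfl fun a _ => ?_
    rw [Finset.sum_comm]
  refine and_congr_right fun _ => ?_
  rw [← key]
  simp only [Set.mem_singleton_iff, forall_eq]

variable {ε : Fin n → Fin n → k}

theorem IsSignMatrix.mul_self (hε : IsSignMatrix ε) (i j : Fin n) : ε i j * ε i j = 1 := by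
  by_cases h : i = j
  · subst h; simp [hε.diag]
  · rcases hε.sign i j h with h | h <;> simp [h]

theorem IsSignMatrix.ne_zero (hε : IsSignMatrix ε) (i j : Fin n) : ε i j ≠ 0 :=
  left_ne_zero_of_mul_eq_one (hε.mul_self i j)

theorem IsSignMatrix.symm (hε : IsSignMatrix ε) (i j : Fin n) : ε i j = ε j i :=
  mul_right_cancel₀ (hε.ne_zero j i) ((hε.mul_swap i j).trans (hε.mul_self j i).symm)

/-- The generator `x_i` of `A^!`. -/
abbrev ADual.x (ε : Fin n → Fin n → k) (i : Fin n) : ADual ε := QuadAlg.gen (quadPerp (relA ε)) i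

theorem sum_unitTensor_mul {T : Type*} [Ring T] [Algebra k T] (y : Fin n → T) (i j : Fin n) :
    ∑ a, ∑ b, unitTensor k i j a b • (y a * y b) = y i * y j :=
  sum_unitTensor i j fun a b => y a * y b

theorem sum_unitTensor_sub {T : Type*} [Ring T] [Algebra k T] (y : Fin n → T) (i j : Fin n)
    (r : k) : ∑ a, ∑ b, (unitTensor k i j - r • unitTensor k j i) a b • (y a * y b) =
      y i * y j - r • (y j * y i) := by
  simp only [Pi.sub_apply, Pi.smul_apply, smul_eq_mul, sub_smul, mul_smul, Finset.sum_sub_distrib,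
    ← Finset.smul_sum, sum_unitTensor]

theorem sum_unitTensor_sub_diag {T : Type*} [Ring T] [Algebra k T] (y : Fin n → T)
    (i j : Fin n) : ∑ a, ∑ b, (unitTensor k i i - unitTensor k j j) a b • (y a * y b) =
      y i * y i - y j * y j := by
  simp only [Pi.sub_apply, sub_smul, Finset.sum_sub_distrib, sum_unitTensor]

theorem QuadAlg.gen_mul_gen_of_mem {R : Submodule k (Fin n → Fin n → k)} {i j : Fin n} {r : k}
    (h : unitTensor k i j - r • unitTensor k j i ∈ R) :
    gen R i * gen R j = r • (gen R j * gen R i) :=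
  sub_eq_zero.1 ((sum_unitTensor_sub (gen R) i j r).symm.trans (QuadAlg.sum_gen_mul_gen h))

theorem QuadAlg.gen_mul_self_of_sub_mem {R : Submodule k (Fin n → Fin n → k)} {i j : Fin n}
    (h : unitTensor k i i - unitTensor k j j ∈ R) : gen R i * gen R i = gen R j * gen R j :=
  sub_eq_zero.1 ((sum_unitTensor_sub_diag (gen R) i j).symm.trans (QuadAlg.sum_gen_mul_gen h))

theorem QuadAlg.gen_mul_self_of_mem {R : Submodule k (Fin n → Fin n → k)} {i : Fin n}
    (h : unitTensor k i i ∈ R) : gen R i * gen R i = 0 :=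
  (sum_unitTensor_mul (gen R) i i).symm.trans (QuadAlg.sum_gen_mul_gen h)

theorem ADual.x_mul_x (hε : IsSignMatrix ε) {i j : Fin n} (h : i ≠ j) :
    ADual.x ε i * ADual.x ε j = (-ε i j) • (ADual.x ε j * ADual.x ε i) := by
  refine QuadAlg.gen_mul_gen_of_mem (mem_quadPerp_relA.2 ⟨fun a b => ?_, ?_⟩)
  · simp only [unitTensor, Pi.sub_apply, Pi.smul_apply, Pi.single_apply, ite_apply, smul_eq_mul,
      Pi.zero_apply]
    have := hε.mul_swap i j
    have := hε.mul_self i j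
    have := hε.symm i j
    split_ifs <;> subst_vars <;> simp_all
  · refine Finset.sum_eq_zero fun a _ => ?_
    simp only [unitTensor, Pi.sub_apply, Pi.smul_apply, Pi.single_apply, ite_apply, smul_eq_mul,
      Pi.zero_apply]
    split_ifs <;> subst_vars <;> simp_all

theorem ADual.x_mul_self (hε : IsSignMatrix ε) (i j : Fin n) :
    ADual.x ε i * ADual.x ε i = ADual.x ε j * ADual.x ε j := by
  have hmem : unitTensor k i i - unitTensor k j j ∈ quadPerp (relA ε) := by
    refine mem_quadPerp_relA.2 ⟨fun a b => ?_, ?_⟩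
    · simp only [unitTensor, Pi.sub_apply, Pi.single_apply, ite_apply, Pi.zero_apply]
      have := hε.diag a
      split_ifs <;> subst_vars <;> simp_all
    · simp [unitTensor, Pi.single_apply, ite_apply, Finset.sum_sub_distrib]
  exact QuadAlg.gen_mul_self_of_sub_mem hmem

/-- The (i,j) and (j,i) terms cancel, since the signs ε_ij from `hy` and `hd` square to 1. The sum
is doubled to pair the terms, then 2 is cancelled. This is what reduces maps out of A^! and S^! to
checking the familiar relations. -/
theorem sum_smul_mul_eq_sum_diag [CharZero k] (hε : IsSignMatrix ε) {T : Type*} [Ring T]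
    [Algebra k T] {y : Fin n → T}
    (hy : ∀ i j, i ≠ j → y i * y j = (-ε i j) • (y j * y i)) {d : Fin n → Fin n → k}
    (hd : ∀ i j, d i j = ε i j * d j i) :
    ∑ i, ∑ j, d i j • (y i * y j) = ∑ i, d i i • (y i * y i) := by
  have h2 : ∀ i j, d i j • (y i * y j) + d j i • (y j * y i) =
      if i = j then (2 : k) • d i i • (y i * y i) else 0 := by
    intro i j
    split_ifs with h
    · subst h; rw [two_smul]
    · rw [hy i j h, hd i j, smul_smul, mul_neg, mul_right_comm, hε.mul_self, one_mul, neg_smul,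
        neg_add_cancel]
  have h3 : (2 : k) • ∑ i, ∑ j, d i j • (y i * y j) = (2 : k) • ∑ i, d i i • (y i * y i) := by
    rw [two_smul]
    nth_rw 2 [Finset.sum_comm]
    simp only [← Finset.sum_add_distrib, h2, Finset.sum_ite_eq, Finset.mem_univ, if_true,
      Finset.smul_sum]
  exact (IsUnit.mk0 (2 : k) two_ne_zero).smul_left_cancel.1 h3

/-- The homomorphism `A^! → T`, `x_i ↦ y_i`. -/
def ADual.lift [CharZero k] (hε : IsSignMatrix ε) {T : Type*} [Ring T] [Algebra k T]
    (y : Fin n → T) (ω : T) (hy : ∀ i j, i ≠ j → y i * y j = (-ε i j) • (y j * y i))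
    (hsq : ∀ i, y i * y i = ω) : ADual ε →ₐ[k] T :=
  QuadAlg.lift _ y fun d hd => by
    rw [mem_quadPerp_relA] at hd
    rw [sum_smul_mul_eq_sum_diag hε hy hd.1]
    simp [hsq, ← Finset.sum_smul, hd.2]

@[simp]
theorem ADual.lift_x [CharZero k] (hε : IsSignMatrix ε) {T : Type*} [Ring T] [Algebra k T]
    (y : Fin n → T) (ω : T) (hy : ∀ i j, i ≠ j → y i * y j = (-ε i j) • (y j * y i))
    (hsq : ∀ i, y i * y i = ω) (i : Fin n) :
    ADual.lift hε y ω hy hsq (ADual.x ε i) = y i :=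
  QuadAlg.lift_gen ..

/-- The homomorphism `S^! → T`, `x_i ↦ y_i`. -/
def SDual.lift [CharZero k] (hε : IsSignMatrix ε) {T : Type*} [Ring T] [Algebra k T]
    (y : Fin n → T) (hy : ∀ i j, i ≠ j → y i * y j = (-ε i j) • (y j * y i))
    (hsq : ∀ i, y i * y i = 0) : SDual ε →ₐ[k] T :=
  QuadAlg.lift _ y fun d hd => by
    rw [mem_quadPerp_relS] at hd
    rw [sum_smul_mul_eq_sum_diag hε hy hd]
    simp [hsq]

theorem SDual.gen_mul_self (hε : IsSignMatrix ε) (i : Fin n) :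
    QuadAlg.gen (quadPerp (relS ε)) i * QuadAlg.gen (quadPerp (relS ε)) i = 0 := by
  have hmem : unitTensor k i i ∈ quadPerp (relS ε) := by
    refine mem_quadPerp_relS.2 fun a b => ?_
    simp only [unitTensor, Pi.single_apply, ite_apply, Pi.zero_apply]
    have := hε.diag a
    split_ifs <;> subst_vars <;> simp_all
  exact QuadAlg.gen_mul_self_of_mem hmem

theorem relS_gen_mul_gen (i j : Fin n) :
    QuadAlg.gen (relS ε) i * QuadAlg.gen (relS ε) j =
      ε i j • (QuadAlg.gen (relS ε) j * QuadAlg.gen (relS ε) i) :=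
  QuadAlg.gen_mul_gen_of_mem (Submodule.subset_span ⟨i, j, rfl⟩)

/-- The homomorphism `S → T`, `x_i ↦ y_i`. -/
def relSLift {T : Type*} [Ring T] [Algebra k T] (y : Fin n → T)
    (hy : ∀ i j, y i * y j = ε i j • (y j * y i)) : QuadAlg (relS ε) →ₐ[k] T :=
  QuadAlg.lift _ y fun c hc => by
    rw [relS] at hc
    induction hc using Submodule.span_induction with
    | mem c hc =>
      obtain ⟨i, j, rfl⟩ := hc
      simp only [Pi.sub_apply, Pi.smul_apply, smul_eq_mul, sub_smul, mul_smul,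
        Finset.sum_sub_distrib, ← Finset.smul_sum, sum_unitTensor]
      exact sub_eq_zero.2 (hy i j)
    | zero => simp
    | add a b _ _ ha hb => simp [add_smul, Finset.sum_add_distrib, ha, hb]
    | smul r a _ ha => simp [mul_smul, ← Finset.smul_sum, ha]

end QuadraticLemmas

/-! ### Which points carry a point module -/

section PointModules

variable {k : Type u} [Field k] {n : ℕ} {ε : Fin n → Fin n → k}

theorem QuadAlg.gen_mem_deg_one (R : Submodule k (Fin n → Fin n → k)) (i : Fin n) :
    QuadAlg.gen R i ∈ QuadAlg.deg R 1 := by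
  rw [QuadAlg.deg, pow_one]
  exact Submodule.subset_span ⟨i, rfl⟩

theorem sum_single_smul {T : Type*} [AddCommGroup T] [Module k T] (y : Fin n → T) (i : Fin n) :
    ∑ j, (Pi.single i 1 : Fin n → k) j • y j = y i := by
  simp [Pi.single_apply, ite_smul]

theorem QuadAlg.op_smul_mem {R : Submodule k (Fin n → Fin n → k)} {M : Type*} [AddCommGroup M]
    [Module k M] [Module (QuadAlg R)ᵐᵒᵖ M] [IsScalarTower k (QuadAlg R)ᵐᵒᵖ M]
    (N : Submodule k M) (hN : ∀ i, ∀ m ∈ N, MulOpposite.op (QuadAlg.gen R i) • m ∈ N)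
    (s : QuadAlg R) : ∀ m ∈ N, MulOpposite.op s • m ∈ N := by
  have hs : s ∈ Algebra.adjoin k (Set.range (QuadAlg.gen R)) := by
    rw [QuadAlg.adjoin_gen]; trivial
  induction hs using Algebra.adjoin_induction with
  | mem x hx => obtain ⟨i, rfl⟩ := hx; exact hN i
  | algebraMap r =>
    intro m hm
    have h : MulOpposite.op (algebraMap k (QuadAlg R) r) • m = r • m := by
      rw [← MulOpposite.algebraMap_apply, algebraMap_smul]
    rw [h]
    exact N.smul_mem r hm
  | add x y _ _ hx hy =>
    intro m hm
    rw [MulOpposite.op_add, add_smul]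
    exact N.add_mem (hx m hm) (hy m hm)
  | mul x y _ _ hx hy =>
    intro m hm
    rw [MulOpposite.op_mul, mul_smul]
    exact hy _ (hx m hm)

/-- With x_s acting by scalars a_s on M_0 → M_1 and q_s on M_1 → M_2, the relations of S read a_s
q_t = ε_st a_t q_s. Going once around i, j, l multiplies q_i by the triple product; if that is not
1, all q_s vanish and M_2 cannot be reached from M_0. -/
theorem sign_mul_sign_mul_sign_of_mem_pointScheme {p : ℙ k (Fin n → k)}
    (hp : p ∈ pointScheme (relS ε)) {i j l : Fin n} (hi : p.rep i ≠ 0) (hj : p.rep j ≠ 0)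
    (hl : p.rep l ≠ 0) : ε i j * ε j l * ε l i = 1 := by
  obtain ⟨M, _, _, _, _, ℳ, hM, hpM⟩ := hp
  obtain ⟨m₀, hm₀, hcyc⟩ := hM.cyclic
  have hgen : ∀ (a : Fin n) (d : ℕ) (m : M), m ∈ ℳ d →
      MulOpposite.op (QuadAlg.gen (relS ε) a) • m ∈ ℳ (d + 1) := fun a d m hm =>
    hM.smul_mem 1 d _ (QuadAlg.gen_mem_deg_one _ a) m hm
  have hbasis : ∀ d, ∃ v ∈ ℳ d, v ≠ 0 ∧ ∀ w ∈ ℳ d, ∃ c : k, c • v = w := by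
    intro d
    obtain ⟨v, hv, h⟩ := finrank_eq_one_iff'.1 (hM.hilbert d)
    refine ⟨v, v.2, fun h0 => hv (Subtype.ext h0), fun w hw => ?_⟩
    obtain ⟨c, hc⟩ := h ⟨w, hw⟩
    exact ⟨c, congrArg Subtype.val hc⟩
  obtain ⟨v₀, hv₀, -, hb₀⟩ := hbasis 0
  obtain ⟨m₁, hm₁, -, hb₁⟩ := hbasis 1
  obtain ⟨m₂, hm₂, hm₂0, hb₂⟩ := hbasis 2
  choose a ha using fun i => hb₁ _ (hgen i 0 v₀ hv₀)
  choose q hq using fun i => hb₂ _ (hgen i 1 m₁ hm₁)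
  have hrel : ∀ s t, a s * q t = ε s t * (a t * q s) := by
    intro s t
    have hst : ∀ s t, MulOpposite.op (QuadAlg.gen (relS ε) s * QuadAlg.gen (relS ε) t) • v₀ =
        (a s * q t) • m₂ := by
      intro s t
      rw [MulOpposite.op_mul, mul_smul, ← ha, smul_comm, ← hq, smul_smul]
    have h := hst s t
    rw [relS_gen_mul_gen, MulOpposite.op_smul, smul_assoc, hst, smul_smul] at h
    exact (smul_left_injective k hm₂0 h).symm
  -- If a_s = 0, then x_s kills M_0, so it is one of the forms that must vanish at p.
  have hane : ∀ s, p.rep s ≠ 0 → a s ≠ 0 := by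
    intro s hs h0
    apply hs
    have h := hpM (Pi.single s 1) ?_
    · simpa [Pi.single_apply] using h
    · intro m hm
      obtain ⟨c, rfl⟩ := hb₀ m hm
      have e := sum_single_smul (k := k) (QuadAlg.gen (relS ε)) s
      rw [e, smul_comm, ← ha, h0, zero_smul, smul_zero]
  by_contra hne
  have hai := hane i hi
  have haj := hane j hj
  have hal := hane l hl
  have hqi : q i = 0 := by
    have h1 := hrel i j
    have h2 := hrel j l
    have h3 := hrel l i
    have h4 : (a i * a j * a l) * ((ε i j * ε j l * ε l i - 1) * q i) = 0 := by
      linear_combination (-a i * a j) * h3 - a i ^ 2 * ε l i * h2 - a i * a l * ε l i * ε j l * h1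
    have h5 : a i * a j * a l ≠ 0 := mul_ne_zero (mul_ne_zero hai haj) hal
    simpa [h5, sub_eq_zero, hne] using h4
  have hq0 : ∀ s, q s = 0 := by
    intro s
    have h := hrel i s
    rw [hqi, mul_zero, mul_zero] at h
    exact (mul_eq_zero.1 h).resolve_left hai
  -- As all q_s vanish, M_0 + M_1 is stable under S; it contains the cyclic generator, so it would
  -- contain M_2.
  have hN := QuadAlg.op_smul_mem (R := relS ε) (ℳ 0 ⊔ ℳ 1) fun s m hm => by
    obtain ⟨x, hx, y, hy, rfl⟩ := Submodule.mem_sup.1 hm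
    obtain ⟨c, rfl⟩ := hb₁ y hy
    rw [smul_add, smul_comm (MulOpposite.op (QuadAlg.gen (relS ε) s)) c, ← hq s, hq0 s, zero_smul, smul_zero, add_zero]
    exact Submodule.mem_sup_right (hgen s 0 x hx)
  have hmem : m₂ ∈ ℳ 0 ⊔ ℳ 1 := by
    have h : m₂ ∈ Submodule.span (QuadAlg (relS ε))ᵐᵒᵖ {m₀} := hcyc ▸ Submodule.mem_top
    obtain ⟨s, rfl⟩ := Submodule.mem_span_singleton.1 h
    exact hN s.unop m₀ (Submodule.mem_sup_left hm₀)
  have hle : ℳ 0 ⊔ ℳ 1 ≤ ⨆ d, ⨆ (_ : d ≠ 2), ℳ d :=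
    sup_le (le_iSup₂_of_le 0 (by decide) le_rfl) (le_iSup₂_of_le 1 (by decide) le_rfl)
  exact hm₂0 (Submodule.disjoint_def.1 (hM.isInternal.submodule_iSupIndep 2) m₂ hm₂ (hle hmem))

/-- The operator `e_d ↦ η ^ d c e_{d+1}`. -/
def twistedShift (η c : k) : Module.End k (ℕ →₀ k) :=
  Finsupp.lift (ℕ →₀ k) k ℕ fun d => Finsupp.single (d + 1) (η ^ d * c)

theorem twistedShift_single (η c r : k) (d : ℕ) :
    twistedShift η c (Finsupp.single d r) = Finsupp.single (d + 1) (r * (η ^ d * c)) := by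
  simp [twistedShift, -Finsupp.single_mul]

/-- Let x_i send e_d to η_i^d p_i e_{d+1}. Acting by x_i then x_j differs from the opposite order by
η_j / η_i = η_i η_j, as η_i² = 1; this is ε_ij wherever p_i p_j ≠ 0, and elsewhere both sides are 0.
-/
theorem mem_pointScheme_of_sign_eq {p : ℙ k (Fin n → k)} (η : Fin n → k)
    (hη : ∀ i, η i * η i = 1)
    (h : ∀ i j, p.rep i ≠ 0 → p.rep j ≠ 0 → ε i j = η i * η j) :
    p ∈ pointScheme (relS ε) := by
  let y : Fin n → (Module.End k (ℕ →₀ k))ᵐᵒᵖ := fun i => MulOpposite.op (twistedShift (η i) (p.rep i))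
  have hy : ∀ i j, y i * y j = ε i j • (y j * y i) := by
    intro i j
    apply MulOpposite.unop_injective
    refine Finsupp.lhom_ext fun d r => ?_
    simp only [y, MulOpposite.unop_mul, MulOpposite.unop_smul, MulOpposite.unop_op,
      Module.End.mul_apply, LinearMap.smul_apply, twistedShift_single, Finsupp.smul_single,
      smul_eq_mul]
    congr 1
    by_cases hi : p.rep i = 0
    · simp [hi]
    by_cases hj : p.rep j = 0
    · simp [hj]
    rw [h i j hi hj, pow_succ, pow_succ]
    linear_combination (-(r * η i ^ d * η j ^ d * p.rep i * p.rep j * η j)) * hη i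
  let ρ : QuadAlg (relS ε) →ₐ[k] (Module.End k (ℕ →₀ k))ᵐᵒᵖ := relSLift y hy
  have hρ : ∀ i, ρ (QuadAlg.gen _ i) = y i := fun i => QuadAlg.lift_gen ..
  let ρ' : (QuadAlg (relS ε))ᵐᵒᵖ →+* Module.End k (ℕ →₀ k) :=
    { toFun := fun s => (ρ s.unop).unop
      map_one' := by simp
      map_mul' := by simp
      map_zero' := by simp
      map_add' := by simp }
  let _ : Module (QuadAlg (relS ε))ᵐᵒᵖ (ℕ →₀ k) := Module.compHom _ ρ'
  have hsmul : ∀ (s : QuadAlg (relS ε)) (m : ℕ →₀ k),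
      MulOpposite.op s • m = (ρ s).unop m := fun _ _ => rfl
  have hgen : ∀ i d r, MulOpposite.op (QuadAlg.gen (relS ε) i) •
      (Finsupp.single d r : ℕ →₀ k) = Finsupp.single (d + 1) (r * (η i ^ d * p.rep i)) := by
    intro i d r
    rw [hsmul, hρ, MulOpposite.unop_op, twistedShift_single]
  have hη0 : ∀ i, η i ≠ 0 := fun i => left_ne_zero_of_mul_eq_one (hη i)
  -- The generator x_{i₀} carries e_d to a nonzero multiple of e_{d+1}, which will give cyclicity.
  obtain ⟨i₀, hi₀⟩ : ∃ i, p.rep i ≠ 0 := by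
    by_contra! h0
    exact p.rep_nonzero (funext h0)
  have htower : IsScalarTower k (QuadAlg (relS ε))ᵐᵒᵖ (ℕ →₀ k) := by
    refine ⟨fun r s m => ?_⟩
    obtain ⟨s, rfl⟩ := MulOpposite.op_surjective s
    rw [← MulOpposite.op_smul, hsmul, hsmul, map_smul]
    rfl
  let ℳ : ℕ → Submodule k (ℕ →₀ k) := fun d => Submodule.span k {Finsupp.single d 1}
  have hmem : ∀ d (m : ℕ →₀ k), m ∈ ℳ d ↔ ∃ r, m = Finsupp.single d r := by
    intro d m
    simp only [ℳ, Submodule.mem_span_singleton, Finsupp.smul_single, smul_eq_mul, mul_one, eq_comm]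
  refine ⟨ℕ →₀ k, inferInstance, inferInstance, inferInstance, htower, ℳ, ⟨?_, ?_, ?_, ?_⟩, ?_⟩
  · rw [DirectSum.isInternal_submodule_iff_iSupIndep_and_iSup_eq_top]
    constructor
    · exact (Finsupp.basisSingleOne (R := k) (ι := ℕ)).linearIndependent.iSupIndep_span_singleton
    · rw [eq_top_iff, ← (Finsupp.basisSingleOne (R := k) (ι := ℕ)).span_eq, Submodule.span_le]
      rintro _ ⟨d, rfl⟩
      exact Submodule.mem_iSup_of_mem d (Submodule.mem_span_singleton_self _)
  · intro d
    induction d with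
    | zero =>
      intro e s hs m hm
      rw [QuadAlg.deg, pow_zero, Submodule.mem_one] at hs
      obtain ⟨r, rfl⟩ := hs
      rw [← MulOpposite.algebraMap_apply, algebraMap_smul]
      exact (ℳ e).smul_mem r hm
    | succ d ih =>
      intro e s hs m hm
      rw [QuadAlg.deg, pow_succ] at hs
      induction hs using Submodule.mul_induction_on' with
      | add x _ y _ hx hy =>
        rw [MulOpposite.op_add, add_smul]
        exact (ℳ _).add_mem hx hy
      | mem_mul_mem a ha b hb =>
        rw [MulOpposite.op_mul, mul_smul]
        obtain ⟨r, hr⟩ := (hmem _ _).1 (ih e a ha m hm)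
        rw [hr]
        clear hr
        induction hb using Submodule.span_induction with
        | mem b hb =>
          obtain ⟨i, rfl⟩ := hb
          rw [hgen]
          exact (hmem _ _).2 ⟨_, rfl⟩
        | zero => rw [MulOpposite.op_zero, zero_smul]; exact (ℳ _).zero_mem
        | add b c _ _ hb hc =>
          rw [MulOpposite.op_add, add_smul]
          exact (ℳ _).add_mem hb hc
        | smul t b _ hb =>
          rw [MulOpposite.op_smul, smul_assoc]
          exact (ℳ _).smul_mem t hb
  · refine ⟨Finsupp.single 0 1, (hmem _ _).2 ⟨_, rfl⟩, ?_⟩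
    have hsingle : ∀ d (r : k), (Finsupp.single d r : ℕ →₀ k) ∈
        Submodule.span (QuadAlg (relS ε))ᵐᵒᵖ {(Finsupp.single 0 1 : ℕ →₀ k)} := by
      intro d
      induction d with
      | zero =>
        intro r
        have h1 : (Finsupp.single 0 r : ℕ →₀ k) =
            (r • (1 : (QuadAlg (relS ε))ᵐᵒᵖ)) • (Finsupp.single 0 1 : ℕ →₀ k) := by
          rw [smul_assoc, one_smul, Finsupp.smul_single, smul_eq_mul, mul_one]
        rw [h1]
        exact Submodule.smul_mem _ _ (Submodule.mem_span_singleton_self _)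
      | succ d ih =>
        intro r
        have h0 : η i₀ ^ d * p.rep i₀ ≠ 0 := mul_ne_zero (pow_ne_zero _ (hη0 i₀)) hi₀
        have h1 := hgen i₀ d (r / (η i₀ ^ d * p.rep i₀))
        rw [div_mul_cancel₀ _ h0] at h1
        rw [← h1]
        exact Submodule.smul_mem _ _ (ih _)
    rw [eq_top_iff]
    rintro m -
    induction m using Finsupp.induction_linear with
    | zero => exact Submodule.zero_mem _
    | add f g hf hg => exact Submodule.add_mem _ hf hg
    | single d r => exact hsingle d r
  · exact fun d => finrank_span_singleton (by simp)
  · intro g hg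
    have h1 := hg (Finsupp.single 0 1) ((hmem _ _).2 ⟨_, rfl⟩)
    have h2 : MulOpposite.op (∑ i, g i • QuadAlg.gen (relS ε) i) =
        ∑ i, g i • MulOpposite.op (QuadAlg.gen (relS ε) i) := by
      rw [Finset.op_sum]; rfl
    rw [h2, Finset.sum_smul] at h1
    have h3 : ∀ i, (g i • MulOpposite.op (QuadAlg.gen (relS ε) i)) •
        (Finsupp.single 0 1 : ℕ →₀ k) = Finsupp.single 1 (g i * p.rep i) := by
      intro i
      rw [smul_assoc, hgen, Finsupp.smul_single]
      simp
    simp only [h3] at h1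
    rw [← Finsupp.single_finsetSum] at h1
    simpa using h1

end PointModules

/-! ### Squarefree monomials and shift operators -/

section Monomials

variable {k B ι : Type*} [Field k] [Ring B] [Algebra k B]

theorem List.Perm.exists_prod_eq_smul {x : ι → B}
    (hx : ∀ i j, ∃ c : k, x i * x j = c • (x j * x i)) {l l' : List ι} (h : l.Perm l') :
    ∃ c : k, (l.map x).prod = c • (l'.map x).prod := by
  induction h with
  | nil => exact ⟨1, by simp⟩
  | cons a _ ih =>
    obtain ⟨c, hc⟩ := ih
    exact ⟨c, by simp [hc]⟩
  | swap a b l =>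
    obtain ⟨c, hc⟩ := hx b a
    exact ⟨c, by simp only [List.map_cons, List.prod_cons, ← mul_assoc, hc, smul_mul_assoc]⟩
  | trans _ _ ih ih' =>
    obtain ⟨c, hc⟩ := ih
    obtain ⟨c', hc'⟩ := ih'
    exact ⟨c * c', by rw [hc, hc', mul_smul]⟩

/-- The product of the `x i` for `i` in `I`, in some order. -/
def squarefreeMonomial (x : ι → B) (I : Finset ι) : B := (I.toList.map x).prod

/-- If the generators `x i` commute up to scalars and have the same square `ω`, which is central,
then the elements `ω ^ m * x_I` span. -/
theorem span_squarefreeMonomial [DecidableEq ι] {x : ι → B} {ω : B}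
    (hx : ∀ i j, ∃ c : k, x i * x j = c • (x j * x i)) (hsq : ∀ i, x i * x i = ω)
    (hω : ∀ i, x i * ω = ω * x i) (hgen : Algebra.adjoin k (Set.range x) = ⊤) :
    Submodule.span k (Set.range fun p : Finset ι × ℕ => ω ^ p.2 * squarefreeMonomial x p.1) =
      ⊤ := by
  set N := Submodule.span k
    (Set.range fun p : Finset ι × ℕ => ω ^ p.2 * squarefreeMonomial x p.1) with hN
  have hmem : ∀ I m, ω ^ m * squarefreeMonomial x I ∈ N := fun I m =>
    Submodule.subset_span ⟨(I, m), rfl⟩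
  have hgenN : ∀ i, ∀ b ∈ N, x i * b ∈ N := by
    intro i b hb
    induction hb using Submodule.span_induction with
    | zero => simp
    | add a b _ _ ha hb => rw [mul_add]; exact N.add_mem ha hb
    | smul r a _ ha => rw [mul_smul_comm]; exact N.smul_mem r ha
    | mem b hb =>
      obtain ⟨⟨I, m⟩, rfl⟩ := hb
      have hcomm : x i * (ω ^ m * squarefreeMonomial x I) =
          ω ^ m * (x i * squarefreeMonomial x I) := by
        rw [← mul_assoc, (show Commute (x i) ω from hω i).pow_right m, mul_assoc]
      dsimp only
      rw [hcomm]
      by_cases hi : i ∈ I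
      -- Bring x_i to the front of x_I, where it meets the other x_i and contributes a factor ω.
      · have hp : I.toList.Perm (i :: (I.erase i).toList) := by
          have := Finset.toList_insert (Finset.notMem_erase i I)
          rwa [Finset.insert_erase hi] at this
        obtain ⟨c, hc⟩ := hp.exists_prod_eq_smul (k := k) hx
        rw [squarefreeMonomial, hc, List.map_cons, List.prod_cons, mul_smul_comm, ← mul_assoc,
          hsq, mul_smul_comm, ← mul_assoc, ← pow_succ]
        exact N.smul_mem c (hmem _ _)
      · have hp := (Finset.toList_insert hi).symm
        obtain ⟨c, hc⟩ := hp.exists_prod_eq_smul (k := k) hx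
        rw [List.map_cons, List.prod_cons] at hc
        rw [squarefreeMonomial, hc, mul_smul_comm]
        exact N.smul_mem c (hmem _ _)
  rw [eq_top_iff]
  rintro a -
  -- The span is a left ideal, and it contains 1.
  have key : ∀ b ∈ N, a * b ∈ N := by
    have ha : a ∈ Algebra.adjoin k (Set.range x) := hgen ▸ Algebra.mem_top
    induction ha using Algebra.adjoin_induction with
    | mem a ha => obtain ⟨i, rfl⟩ := ha; exact hgenN i
    | algebraMap r =>
      intro b hb
      rw [← Algebra.smul_def]
      exact N.smul_mem r hb
    | add a b _ _ ha hb =>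
      intro c hc
      rw [add_mul]
      exact N.add_mem (ha c hc) (hb c hc)
    | mul a b _ _ ha hb =>
      intro c hc
      rw [mul_assoc]
      exact ha _ (hb c hc)
  have h1 : (1 : B) ∈ N := by simpa [squarefreeMonomial] using hmem ∅ 0
  simpa using key 1 h1

variable {Γ : Type*} [AddCommMonoid Γ]

/-- The operator `T` maps each basis vector `e_g` to a nonzero multiple of `e_{g + γ}`. -/
def IsShift (T : Module.End k (Γ →₀ k)) (γ : Γ) : Prop :=
  ∀ g, ∃ c : k, c ≠ 0 ∧ T (Finsupp.single g 1) = Finsupp.single (g + γ) c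

theorem IsShift.one : IsShift (1 : Module.End k (Γ →₀ k)) 0 :=
  fun g => ⟨1, one_ne_zero, by simp⟩

theorem IsShift.mul {T U : Module.End k (Γ →₀ k)} {γ δ : Γ} (hT : IsShift T γ)
    (hU : IsShift U δ) : IsShift (T * U) (γ + δ) := by
  intro g
  obtain ⟨c, hc, h⟩ := hU g
  obtain ⟨c', hc', h'⟩ := hT (g + δ)
  refine ⟨c * c', mul_ne_zero hc hc', ?_⟩
  rw [Module.End.mul_apply, h, ← mul_one c, ← smul_eq_mul, ← Finsupp.smul_single, map_smul, h',
    Finsupp.smul_single, smul_eq_mul, smul_eq_mul, mul_one, add_assoc, add_comm δ]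

theorem IsShift.smul {T : Module.End k (Γ →₀ k)} {γ : Γ} (hT : IsShift T γ) {r : k}
    (hr : r ≠ 0) : IsShift (r • T) γ := by
  intro g
  obtain ⟨c, hc, h⟩ := hT g
  exact ⟨r * c, mul_ne_zero hr hc, by rw [LinearMap.smul_apply, h, Finsupp.smul_single,
    smul_eq_mul]⟩

theorem IsShift.pow {T : Module.End k (Γ →₀ k)} {γ : Γ} (hT : IsShift T γ) (m : ℕ) :
    IsShift (T ^ m) (m • γ) := by
  induction m with
  | zero => simpa using IsShift.one
  | succ m ih => rw [pow_succ, succ_nsmul]; exact ih.mul hT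

theorem IsShift.ne_zero {T : Module.End k (Γ →₀ k)} {γ : Γ} (hT : IsShift T γ) : T ≠ 0 := by
  rintro rfl
  obtain ⟨c, hc, h⟩ := hT 0
  exact hc (by simpa using h.symm)

theorem IsShift.squarefreeMonomial {ρ : B →ₐ[k] Module.End k (Γ →₀ k)} {x : ι → B} {γ : ι → Γ}
    (h : ∀ i, IsShift (ρ (x i)) (γ i)) (I : Finset ι) :
    IsShift (ρ (squarefreeMonomial x I)) (∑ i ∈ I, γ i) := by
  have hl : ∀ l : List ι, IsShift (ρ (l.map x).prod) (l.map γ).sum := by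
    intro l
    induction l with
    | nil => simpa using IsShift.one
    | cons a l ih =>
      rw [List.map_cons, List.prod_cons, map_mul, List.map_cons, List.sum_cons]
      exact (h a).mul ih
  rw [← Finset.sum_map_toList]
  exact hl _

/-- A spanning family on which a representation acts by shifts by distinct amounts is linearly
independent, and `e_0` is a separating vector. -/
theorem IsShift.apply_injective {σ : Type*} {b : σ → B} {ρ : B →ₐ[k] Module.End k (Γ →₀ k)}
    {γ : σ → Γ} (hb : Submodule.span k (Set.range b) = ⊤) (h : ∀ s, IsShift (ρ (b s)) (γ s))
    (hγ : Function.Injective γ) :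
    Function.Injective fun a => ρ a (Finsupp.single 0 1) := by
  choose c hc hρ using fun s => h s 0
  let φ : B →ₗ[k] Γ →₀ k := (LinearMap.applyₗ (Finsupp.single 0 1)).comp ρ.toLinearMap
  have hφ : ∀ s, φ (b s) = Finsupp.single (γ s) (c s) := fun s => by
    simpa [φ] using hρ s
  have hinj : Function.Injective φ := by
    rw [injective_iff_map_eq_zero]
    intro a ha
    obtain ⟨f, rfl⟩ := (Finsupp.mem_span_range_iff_exists_finsupp).1
      (show a ∈ Submodule.span k (Set.range b) from hb ▸ Submodule.mem_top)
    suffices hf : f = 0 by simp [hf]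
    ext s
    -- Distinct shifts put the images of e_0 on distinct basis vectors, so the coordinate at γ s
    -- sees only the coefficient of b s.
    have h2 := DFunLike.congr_fun ha (γ s)
    rw [Finsupp.sum, map_sum] at h2
    simp only [map_smul, hφ, Finsupp.smul_single, smul_eq_mul, Finsupp.coe_zero, Pi.zero_apply,
      Finsupp.finsetSum_apply] at h2
    rw [Finset.sum_eq_single s (fun t _ hts => Finsupp.single_eq_of_ne' (hγ.ne hts))
      (fun hs => by simp [Finsupp.notMem_support_iff.1 hs]), Finsupp.single_eq_same] at h2
    exact (mul_eq_zero.1 h2).resolve_right (hc s)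
  exact hinj

end Monomials

/-! ### The sign-twisted shift representation of A^! -/

section ShiftRepresentation

variable {k : Type u} [Field k] {n : ℕ} {ε : Fin n → Fin n → k}

/-- The sign `∏_{j < i} (-ε_ij) ^ {g_j}` picked up when moving `x_i` past `∏_{j < i} x_j ^ {g_j}`. -/
def swapSign (ε : Fin n → Fin n → k) (i : Fin n) (g : Fin n → ZMod 2) : k :=
  ∏ j ∈ Finset.univ.filter (· < i), (-ε i j) ^ (g j).val

/-- The exponents are representatives 0 or 1 of classes mod 2, but each base -ε_ij squares to 1, so
only the class matters and the sign is a character of (ℤ/2)^n. -/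
theorem swapSign_add (hε : IsSignMatrix ε) (i : Fin n) (g h : Fin n → ZMod 2) :
    swapSign ε i (g + h) = swapSign ε i g * swapSign ε i h := by
  rw [swapSign, swapSign, swapSign, ← Finset.prod_mul_distrib]
  refine Finset.prod_congr rfl fun j _ => ?_
  have h2 : ∀ a b : ZMod 2, ((a + b).val = a.val + b.val) ∨ (a.val + b.val = (a + b).val + 2) := by
    decide
  rw [Pi.add_apply, ← pow_add]
  rcases h2 (g j) (h j) with h | h
  · rw [h]
  · rw [h, pow_add, sq, neg_mul_neg, hε.mul_self, mul_one]

theorem swapSign_single (i j : Fin n) :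
    swapSign ε i (Pi.single j 1) = if j < i then -ε i j else 1 := by
  rw [swapSign]
  split_ifs with h
  · rw [Finset.prod_eq_single j]
    · simp [ZMod.val_one]
    · intro b _ hb
      simp [hb]
    · simp [h]
  · refine Finset.prod_eq_one fun b hb => ?_
    have hbj : b ≠ j := by rintro rfl; exact h (by simpa using hb)
    simp [hbj]

theorem swapSign_mul_self (hε : IsSignMatrix ε) (i : Fin n) (g : Fin n → ZMod 2) :
    swapSign ε i g * swapSign ε i g = 1 := by
  rw [← swapSign_add hε]
  have : g + g = 0 := funext fun j => CharTwo.add_self_eq_zero _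
  rw [this]
  simp [swapSign]

/-- `A^!` acts on the span of a commutative monoid `Γ` over `(ℤ/2)^n`, with `x_i` shifting
by `γ_i`. -/
theorem ADual.exists_shiftRep [CharZero k] (hε : IsSignMatrix ε) {Γ : Type*} [AddCommMonoid Γ]
    (π : Γ →+ (Fin n → ZMod 2)) (γ : Fin n → Γ) (κ : Γ) (hπ : ∀ i, π (γ i) = Pi.single i 1)
    (hκ : ∀ i, γ i + γ i = κ) :
    ∃ ρ : ADual ε →ₐ[k] Module.End k (Γ →₀ k), (∀ i, IsShift (ρ (ADual.x ε i)) (γ i)) ∧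
      ∀ i, ρ (ADual.x ε i * ADual.x ε i) = Finsupp.lmapDomain k k (· + κ) := by
  let X : Fin n → Module.End k (Γ →₀ k) := fun i =>
    Finsupp.lift (Γ →₀ k) k Γ fun g => Finsupp.single (g + γ i) (swapSign ε i (π g))
  have hX : ∀ i g r, X i (Finsupp.single g r) =
      Finsupp.single (g + γ i) (r * swapSign ε i (π g)) := by
    intro i g r
    simp [X, -Finsupp.single_mul]
  have hsw : ∀ i j, i ≠ j → X i * X j = (-ε i j) • (X j * X i) := by
    intro i j hij
    refine Finsupp.lhom_ext fun g r => ?_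
    simp only [Module.End.mul_apply, LinearMap.smul_apply, hX, Finsupp.smul_single, map_add, hπ,
      swapSign_add hε, swapSign_single, smul_eq_mul, add_right_comm g (γ i)]
    congr 1
    -- Only the operator with the larger index sees the other generator, so exactly one of the two
    -- orders acquires the extra sign.
    rcases lt_or_gt_of_ne hij with h | h
    · rw [if_neg h.not_gt, if_pos h]
      linear_combination (-(r * swapSign ε j (π g) * swapSign ε i (π g))) * hε.mul_swap i j
    · rw [if_pos h, if_neg h.not_gt]
      ring
  have hsq : ∀ i, X i * X i = Finsupp.lmapDomain k k (· + κ) := by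
    intro i
    refine Finsupp.lhom_ext fun g r => ?_
    simp only [Module.End.mul_apply, hX, map_add, hπ, swapSign_add hε, swapSign_single,
      lt_irrefl, if_false, mul_one, Finsupp.lmapDomain_apply, Finsupp.mapDomain_single, mul_assoc,
      swapSign_mul_self hε, add_assoc, hκ]
  refine ⟨ADual.lift hε X _ hsw hsq, fun i g => ?_, fun i => ?_⟩
  · rw [ADual.lift_x, hX, one_mul]
    exact ⟨_, left_ne_zero_of_mul_eq_one (swapSign_mul_self hε i _), rfl⟩
  · rw [map_mul, ADual.lift_x, hsq]

end ShiftRepresentation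

/-! ### The central element ω = x_i² and the uniqueness of w up to scalars -/

section Hypersurface

variable {k : Type u} [Field k] {n : ℕ} {ε : Fin n → Fin n → k}

theorem ADual.exists_x_mul_x (hε : IsSignMatrix ε) (i j : Fin n) :
    ∃ c : k, ADual.x ε i * ADual.x ε j = c • (ADual.x ε j * ADual.x ε i) := by
  by_cases h : i = j
  · subst h; exact ⟨1, (one_smul _ _).symm⟩
  · exact ⟨_, ADual.x_mul_x hε h⟩

theorem ADual.x_mul_sq (hε : IsSignMatrix ε) (i₀ i : Fin n) :
    ADual.x ε i * (ADual.x ε i₀ * ADual.x ε i₀) =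
      ADual.x ε i₀ * ADual.x ε i₀ * ADual.x ε i := by
  rw [ADual.x_mul_self hε i₀ i, mul_assoc]

theorem ADual.sq_mem_center (hε : IsSignMatrix ε) (i₀ : Fin n) :
    ADual.x ε i₀ * ADual.x ε i₀ ∈ Subalgebra.center k (ADual ε) := by
  rw [Subalgebra.mem_center_iff]
  intro a
  have ha : a ∈ Algebra.adjoin k (Set.range (ADual.x ε)) :=
    (QuadAlg.adjoin_gen (quadPerp (relA ε))).symm ▸ Algebra.mem_top
  induction ha using Algebra.adjoin_induction with
  | mem a ha => obtain ⟨i, rfl⟩ := ha; exact ADual.x_mul_sq hε i₀ i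
  | algebraMap r => exact Algebra.commutes r _
  | add a b _ _ ha hb => rw [add_mul, ha, hb, mul_add]
  | mul a b _ _ ha hb => rw [mul_assoc, hb, ← mul_assoc, ha, mul_assoc]

theorem sum_single_one_injective :
    Function.Injective fun I : Finset (Fin n) => ∑ i ∈ I, (Pi.single i 1 : Fin n → ZMod 2) := by
  have key : ∀ (I : Finset (Fin n)) j,
      (∑ i ∈ I, (Pi.single i 1 : Fin n → ZMod 2)) j = if j ∈ I then 1 else 0 := by
    intro I j
    rw [Finset.sum_apply]
    simp [Pi.single_apply]
  intro I J h
  ext j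
  have hj := congrFun h j
  simp only [key] at hj
  by_cases hI : j ∈ I <;> by_cases hJ : j ∈ J <;> simp_all

/-- Take Γ = (ℤ/2)^n × ℕ, the second factor recording degree. Then ω^m x_I shifts by the pair
(indicator of I, 2m + |I|), which determines I and then m. -/
theorem ADual.exists_gradedRep [CharZero k] (hε : IsSignMatrix ε) (i₀ : Fin n) :
    ∃ ρ : ADual ε →ₐ[k] Module.End k ((Fin n → ZMod 2) × ℕ →₀ k),
      ρ (ADual.x ε i₀ * ADual.x ε i₀) = Finsupp.lmapDomain k k (· + ((0, 2) : _ × ℕ)) ∧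
      Function.Injective fun a => ρ a (Finsupp.single 0 1) := by
  obtain ⟨ρ, h1, h2⟩ := ADual.exists_shiftRep hε (AddMonoidHom.fst (Fin n → ZMod 2) ℕ)
    (fun i => (Pi.single i 1, 1)) (0, 2) (fun _ => rfl)
    (fun i => Prod.ext (funext fun j => CharTwo.add_self_eq_zero _) rfl)
  refine ⟨ρ, h2 i₀, ?_⟩
  have hspan := span_squarefreeMonomial (k := k) (ADual.exists_x_mul_x hε)
    (fun i => ADual.x_mul_self hε i i₀) (ADual.x_mul_sq hε i₀) (QuadAlg.adjoin_gen _)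
  refine IsShift.apply_injective (ρ := ρ) hspan (fun p => ?_)
    (γ := fun p => p.2 • ((Pi.single i₀ 1, 1) + (Pi.single i₀ 1, 1)) +
      ∑ i ∈ p.1, ((Pi.single i 1 : Fin n → ZMod 2), 1)) ?_
  · rw [map_mul, map_pow, map_mul]
    exact (((h1 i₀).mul (h1 i₀)).pow _).mul (IsShift.squarefreeMonomial h1 _)
  · have h0 : ((Pi.single i₀ 1 : Fin n → ZMod 2), 1) + (Pi.single i₀ 1, 1) = (0, 2) :=
      Prod.ext (funext fun j => CharTwo.add_self_eq_zero _) rfl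
    rintro ⟨I, a⟩ ⟨J, b⟩ h
    simp only [h0, Prod.ext_iff, Prod.fst_add, Prod.snd_add, Prod.smul_fst, Prod.smul_snd,
      smul_zero, zero_add, Prod.fst_sum, Prod.snd_sum] at h
    obtain rfl : I = J := sum_single_one_injective h.1
    have := h.2
    simp at this
    rw [this]

/-- In the faithful graded representation ω acts as translation by (0, 2), which is injective;
centrality handles the other side. -/
theorem ADual.sq_isRegular [CharZero k] (hε : IsSignMatrix ε) (i₀ : Fin n) :
    IsRegular (ADual.x ε i₀ * ADual.x ε i₀) := by
  obtain ⟨ρ, h1, h2⟩ := ADual.exists_gradedRep hε i₀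
  have hl : IsLeftRegular (ADual.x ε i₀ * ADual.x ε i₀) := by
    intro a b hab
    apply h2
    dsimp only at hab ⊢
    have h3 := congrArg (fun z => ρ z (Finsupp.single 0 1)) hab
    simp only [map_mul ρ (ADual.x ε i₀ * ADual.x ε i₀), h1, Module.End.mul_apply,
      Finsupp.lmapDomain_apply] at h3
    exact Finsupp.mapDomain_injective (add_left_injective _) h3
  refine ⟨hl, fun a b hab => hl ?_⟩
  have hc := Subalgebra.mem_center_iff.1 (ADual.sq_mem_center hε i₀)
  dsimp only at hab ⊢
  rw [← hc, ← hc, hab]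

theorem ADual.sq_ne_zero [CharZero k] (hε : IsSignMatrix ε) (i₀ : Fin n) :
    ADual.x ε i₀ * ADual.x ε i₀ ≠ 0 := by
  obtain ⟨ρ, h1, -⟩ := ADual.exists_gradedRep hε i₀
  intro h
  rw [h, map_zero] at h1
  have h2 := LinearMap.congr_fun h1 (Finsupp.single 0 1)
  rw [LinearMap.zero_apply, Finsupp.lmapDomain_apply, Finsupp.mapDomain_single] at h2
  exact one_ne_zero (Finsupp.single_eq_zero.1 h2.symm)

/-- The quotient of A^! by the ideal of ω satisfies the relations of S^!, so the quotient map
factors through A^! → S^!. -/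
theorem ker_dualProj [CharZero k] (hε : IsSignMatrix ε) (i₀ : Fin n) :
    RingHom.ker (dualProj ε) = Ideal.span {ADual.x ε i₀ * ADual.x ε i₀} := by
  set I : Ideal (ADual ε) := Ideal.span {ADual.x ε i₀ * ADual.x ε i₀} with hI
  have hc := Subalgebra.mem_center_iff.1 (ADual.sq_mem_center hε i₀)
  have : I.IsTwoSided := by
    refine ⟨fun b ha => ?_⟩
    obtain ⟨a, rfl⟩ := Ideal.mem_span_singleton'.1 ha
    rw [mul_assoc, ← hc, ← mul_assoc]
    exact Ideal.mul_mem_left _ _ (Ideal.mem_span_singleton_self _)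
  apply le_antisymm
  · let q : ADual ε →ₐ[k] ADual ε ⧸ I := Ideal.Quotient.mkₐ k I
    let f : SDual ε →ₐ[k] ADual ε ⧸ I := SDual.lift hε (fun i => q (ADual.x ε i))
      (fun i j h => by rw [← map_mul, ADual.x_mul_x hε h, map_smul, map_mul])
      (fun i => by
        rw [← map_mul, ADual.x_mul_self hε i i₀]
        exact Ideal.Quotient.eq_zero_iff_mem.2 (Ideal.mem_span_singleton_self _))
    have hf : f.comp (dualProj ε) = q := by
      refine QuadAlg.algHom_ext fun i => ?_
      rw [AlgHom.comp_apply, dualProj, QuadAlg.proj_gen]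
      exact QuadAlg.lift_gen ..
    intro a ha
    have h1 : q a = 0 := by
      rw [← hf, AlgHom.comp_apply, (RingHom.mem_ker).1 ha, map_zero]
    exact Ideal.Quotient.eq_zero_iff_mem.1 h1
  · rw [hI, Ideal.span_singleton_le_iff_mem, RingHom.mem_ker, map_mul, dualProj, QuadAlg.proj_gen]
    exact SDual.gen_mul_self hε i₀

theorem ADual.x_mul_x_mem_deg_two (i j : Fin n) :
    ADual.x ε i * ADual.x ε j ∈ QuadAlg.deg (quadPerp (relA ε)) 2 := by
  rw [QuadAlg.deg, pow_two]
  exact Submodule.mul_mem_mul (Submodule.subset_span ⟨i, rfl⟩) (Submodule.subset_span ⟨j, rfl⟩)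

theorem isHypersurfaceElement_sq [CharZero k] (hε : IsSignMatrix ε) (i₀ : Fin n) :
    IsHypersurfaceElement ε ⟨_, ADual.sq_mem_center hε i₀⟩ where
  mem_deg := ADual.x_mul_x_mem_deg_two i₀ i₀
  regular := ADual.sq_isRegular hε i₀
  ker_eq := ker_dualProj hε i₀

open Polynomial in
/-- An element of degree two which is divisible by `x_i²` is a scalar multiple of it. -/
theorem ADual.exists_eq_smul_sq [CharZero k] (hε : IsSignMatrix ε) (i₀ : Fin n) {w a : ADual ε}
    (hw : w ∈ QuadAlg.deg (quadPerp (relA ε)) 2) (h : w = a * (ADual.x ε i₀ * ADual.x ε i₀)) :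
    ∃ c : k, w = c • (ADual.x ε i₀ * ADual.x ε i₀) := by
  -- This map records the grading: x_i goes to x_i X, and an element of degree d to its multiple by
  -- X^d. In the X² coefficient of w = a ω only the constant coefficient of Δ a survives, and that
  -- is a scalar.
  let Δ : ADual ε →ₐ[k] (ADual ε)[X] := ADual.lift hε (fun i => monomial 1 (ADual.x ε i))
    (monomial 2 (ADual.x ε i₀ * ADual.x ε i₀))
    (fun i j h => by
      rw [monomial_mul_monomial, monomial_mul_monomial, smul_monomial, ADual.x_mul_x hε h])
    (fun i => by rw [monomial_mul_monomial, ADual.x_mul_self hε i i₀])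
  have hx : ∀ i, Δ (ADual.x ε i) = monomial 1 (ADual.x ε i) := fun i => ADual.lift_x ..
  have h1 : ∀ v ∈ Submodule.span k (Set.range (QuadAlg.gen (quadPerp (relA ε)))),
      Δ v = monomial 1 v := by
    intro v hv
    induction hv using Submodule.span_induction with
    | mem v hv => obtain ⟨i, rfl⟩ := hv; exact hx i
    | zero => simp
    | add a b _ _ ha hb => rw [map_add, ha, hb, map_add]
    | smul r a _ ha => rw [map_smul, ha, smul_monomial]
  have h2 : Δ w = monomial 2 w := by
    clear h
    rw [QuadAlg.deg, pow_two] at hw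
    induction hw using Submodule.mul_induction_on' with
    | mem_mul_mem a ha b hb => rw [map_mul, h1 a ha, h1 b hb, monomial_mul_monomial]
    | add a _ b _ ha hb => rw [map_add, ha, hb, map_add]
  have h0 : ∀ b, ∃ c : k, (Δ b).coeff 0 = algebraMap k (ADual ε) c := by
    intro b
    have hb : b ∈ Algebra.adjoin k (Set.range (ADual.x ε)) :=
      (QuadAlg.adjoin_gen (quadPerp (relA ε))).symm ▸ Algebra.mem_top
    induction hb using Algebra.adjoin_induction with
    | mem a ha =>
      obtain ⟨i, rfl⟩ := ha
      exact ⟨0, by rw [hx, coeff_monomial, map_zero, if_neg one_ne_zero]⟩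
    | algebraMap r =>
      exact ⟨r, by rw [AlgHom.commutes, Polynomial.algebraMap_apply, coeff_C_zero]⟩
    | add a b _ _ ha hb =>
      obtain ⟨c, hc⟩ := ha
      obtain ⟨d, hd⟩ := hb
      exact ⟨c + d, by rw [map_add, coeff_add, hc, hd, map_add]⟩
    | mul a b _ _ ha hb =>
      obtain ⟨c, hc⟩ := ha
      obtain ⟨d, hd⟩ := hb
      exact ⟨c * d, by rw [map_mul, mul_coeff_zero, hc, hd, map_mul]⟩
  obtain ⟨c, hc⟩ := h0 a
  refine ⟨c, ?_⟩
  have h3 := congrArg (fun p => coeff p 2) (congrArg Δ h)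
  simp only [h2, map_mul, hx, monomial_mul_monomial, coeff_monomial_same] at h3
  rw [h3, show (2 : ℕ) = 0 + (1 + 1) from rfl, coeff_mul_monomial, hc, Algebra.smul_def]

/-- Both w and ω generate the kernel of A^! → S^!, so w is a multiple of ω, by a scalar for degree
reasons; the scalar is nonzero because ω is. -/
theorem IsHypersurfaceElement.exists_eq_smul_sq [CharZero k] (hε : IsSignMatrix ε)
    {w : Subalgebra.center k (ADual ε)} (hw : IsHypersurfaceElement ε w) (i₀ : Fin n) :
    ∃ c : k, c ≠ 0 ∧ (w : ADual ε) = c • (ADual.x ε i₀ * ADual.x ε i₀) := by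
  have hker := hw.ker_eq
  rw [ker_dualProj hε i₀] at hker
  obtain ⟨a, ha⟩ := Ideal.mem_span_singleton'.1
    (hker ▸ Ideal.mem_span_singleton_self (w : ADual ε))
  obtain ⟨c, hc⟩ := ADual.exists_eq_smul_sq hε i₀ hw.mem_deg ha.symm
  refine ⟨c, ?_, hc⟩
  rintro rfl
  obtain ⟨b, hb⟩ := Ideal.mem_span_singleton'.1
    (hker.symm ▸ Ideal.mem_span_singleton_self (ADual.x ε i₀ * ADual.x ε i₀))
  rw [hc, zero_smul, mul_zero] at hb
  exact ADual.sq_ne_zero hε i₀ hb.symm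

end Hypersurface

/-! ### The Clifford presentation of the degree zero part -/

section Clifford

variable {k : Type u} [Field k]

theorem mul_base_mul_mul_base {n : ℕ} {ε : Fin n → Fin n → k} {T : Type*} [Ring T] [Algebra k T]
    {y : Fin n → T} {ω : T} (hy : ∀ i j, i ≠ j → y i * y j = (-ε i j) • (y j * y i))
    (hsq : ∀ i, y i * y i = ω) (i : Fin n) {j o : Fin n} (h : o ≠ j) :
    y i * y o * (y j * y o) = (-ε o j) • (y i * y j * ω) := by
  rw [mul_assoc, ← mul_assoc (y o), hy o j h, smul_mul_assoc, mul_smul_comm, mul_assoc (y j), hsq,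
    mul_assoc]

theorem commute_of_pow_mul_eq {L : Type*} [Monoid L] {W : Lˣ} {a b : L} {r : ℕ}
    (h : (W : L) ^ r * b = a) (ha : Commute (W : L) a) : Commute (W : L) b := by
  have hb : b = ↑(W ^ r)⁻¹ * a := by
    rw [← h, ← Units.val_pow_eq_pow_val, Units.inv_mul_cancel_left]
  rw [hb]
  exact Commute.mul_right ((Commute.refl W).pow_right r).inv_right.units_val ha

theorem ADual.commute_map_of_eq_smul_sq {n : ℕ} {ε : Fin n → Fin n → k} (hε : IsSignMatrix ε)
    {L : Type*} [Ring L] [Algebra k L] (ι : ADual ε →ₐ[k] L) {W : L} {c : k} {i₀ : Fin n}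
    (hW : W = c • ι (ADual.x ε i₀ * ADual.x ε i₀)) (a : ADual ε) : Commute W (ι a) := by
  rw [hW]
  refine Commute.smul_left ?_ c
  rw [commute_iff_eq, ← map_mul, ← map_mul,
    (Subalgebra.mem_center_iff.1 (ADual.sq_mem_center hε i₀) a)]

theorem adjoin_cliffordRel (s : k) (m : ℕ) : Algebra.adjoin k (Set.range fun i =>
    RingQuot.mkAlgHom k (CliffordRel s m) (FreeAlgebra.ι k i)) = ⊤ := by
  have h : (Set.range fun i => RingQuot.mkAlgHom k (CliffordRel s m) (FreeAlgebra.ι k i)) =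
      RingQuot.mkAlgHom k (CliffordRel s m) '' Set.range (FreeAlgebra.ι k) := by
    rw [← Set.range_comp]; rfl
  rw [h, ← AlgHom.map_adjoin, FreeAlgebra.adjoin_range_ι, Algebra.map_top, AlgHom.range_eq_top]
  exact RingQuot.mkAlgHom_surjective k _

/-- This is the general spanning statement with ω = 1, so that powers of ω disappear. -/
theorem span_cliffordRel (s : k) (m : ℕ) :
    Submodule.span k (Set.range fun I : Finset (Fin m) => squarefreeMonomial
      (fun i => RingQuot.mkAlgHom k (CliffordRel s m) (FreeAlgebra.ι k i)) I) = ⊤ := by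
  set t := fun i => RingQuot.mkAlgHom k (CliffordRel s m) (FreeAlgebra.ι k i) with ht
  have hsq : ∀ i, t i * t i = 1 := fun i => by
    rw [ht, ← map_mul, RingQuot.mkAlgHom_rel k (CliffordRel.sq i), map_one]
  have hx : ∀ i j, ∃ c : k, t i * t j = c • (t j * t i) := by
    intro i j
    by_cases h : i = j
    · subst h; exact ⟨1, (one_smul _ _).symm⟩
    · refine ⟨s, ?_⟩
      rw [ht, ← map_mul, RingQuot.mkAlgHom_rel k (CliffordRel.swap i j h), map_smul, map_mul]
  rw [eq_top_iff, ← span_squarefreeMonomial hx hsq (fun i => by rw [one_mul, mul_one])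
    (adjoin_cliffordRel s m)]
  refine Submodule.span_mono ?_
  rintro _ ⟨p, rfl⟩
  exact ⟨p.1, by simp only [one_pow, one_mul]⟩

/-- The nonzero indices already recover I; coordinate 0 holds only the parity of |I|. These are the
shifts produced by products of the x_i x_0. -/
theorem sum_single_succ_add_single_zero_injective {m : ℕ} :
    Function.Injective fun I : Finset (Fin m) =>
      ∑ i ∈ I, (Pi.single i.succ 1 + Pi.single 0 1 : Fin (m + 1) → ZMod 2) := by
  have key : ∀ (I : Finset (Fin m)) j,
      (∑ i ∈ I, (Pi.single i.succ 1 + Pi.single 0 1 : Fin (m + 1) → ZMod 2)) j.succ =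
        if j ∈ I then 1 else 0 := by
    intro I j
    rw [Finset.sum_apply]
    simp [Pi.single_apply]
  intro I J h
  ext j
  have hj := congrFun h j.succ
  simp only [key] at hj
  by_cases hI : j ∈ I <;> by_cases hJ : j ∈ J <;> simp_all

/-- The degree zero part `D` of a localization `L` of `A^!` at a nonzero multiple of `x_0²` is
presented by the generators `x_i x_0 / x_0²`, up to scalars. -/
theorem ADual.nonempty_equiv_clifford [CharZero k] [IsAlgClosed k] {m : ℕ}
    {ε : Fin (m + 1) → Fin (m + 1) → k} (hε : IsSignMatrix ε) {L : Type*} [Ring L] [Algebra k L]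
    (ι : ADual ε →ₐ[k] L) (W : Lˣ) {c : k} (hc : c ≠ 0)
    (hW : (W : L) = c • ι (ADual.x ε 0 * ADual.x ε 0)) (D : Subalgebra k L)
    (hD : ∀ b, b ∈ D ↔ ∃ r, ∃ a ∈ QuadAlg.deg (quadPerp (relA ε)) (2 * r), (W : L) ^ r * b = ι a)
    (ρ : L →ₐ[k] Module.End k ((Fin (m + 1) → ZMod 2) →₀ k))
    (hρ : ∀ i, IsShift (ρ (ι (ADual.x ε i))) (Pi.single i 1)) (hρW : ρ W = c • 1) {s : k}
    (hs : ∀ i j : Fin m, i ≠ j → -(ε i.succ j.succ * ε 0 i.succ * ε 0 j.succ) = s) :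
    Nonempty (D ≃ₐ[k] RingQuot (CliffordRel s m)) := by
  let y : Fin (m + 1) → L := fun i => ι (ADual.x ε i)
  have hy : ∀ i j, i ≠ j → y i * y j = (-ε i j) • (y j * y i) := fun i j h => by
    simp only [y, ← map_mul, ← map_smul, ADual.x_mul_x hε h]
  have hsq : ∀ i, y i * y i = c⁻¹ • (W : L) := fun i => by
    simp only [y, ← map_mul, ADual.x_mul_self hε i 0, hW, smul_smul, inv_mul_cancel₀ hc, one_smul]
  have hWι := ADual.commute_map_of_eq_smul_sq hε ι hW
  have hWD : ∀ b ∈ D, Commute (W : L) b := by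
    intro b hb
    obtain ⟨r, a, -, h⟩ := (hD b).1 hb
    exact commute_of_pow_mul_eq h (hWι a)
  have hprod := mul_base_mul_mul_base hy hsq
  -- Since (x_i x_0)² = -ε_0i ω² and W = c ω, this square root is the factor that makes l_i x_i x_0
  -- / W square to 1.
  choose l hl using fun i : Fin m => IsAlgClosed.exists_eq_mul_self (-ε 0 i.succ * c ^ 2)
  have hl0 : ∀ i, l i ≠ 0 := fun i h => by
    have h1 := hl i
    rw [h, mul_zero] at h1
    exact mul_ne_zero (neg_ne_zero.2 (hε.ne_zero _ _)) (pow_ne_zero 2 hc) h1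
  let τ : Fin m → L := fun i => l i • (↑W⁻¹ * (y i.succ * y 0))
  have hWτ : ∀ i, (W : L) * τ i = l i • (y i.succ * y 0) := fun i => by
    simp only [τ, mul_smul_comm, Units.mul_inv_cancel_left]
  have hτD : ∀ i, τ i ∈ D := by
    intro i
    refine (hD _).2 ⟨1, l i • (ADual.x ε i.succ * ADual.x ε 0), ?_, ?_⟩
    · exact Submodule.smul_mem _ _ (ADual.x_mul_x_mem_deg_two _ _)
    · rw [pow_one, hWτ, map_smul, map_mul]
  have hττ : ∀ i j, (W : L) * W * (τ i * τ j) =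
      (l i * l j * -ε 0 j.succ * c⁻¹) • (y i.succ * y j.succ * (W : L)) := by
    intro i j
    have h1 : (W : L) * W * (τ i * τ j) = (W * τ i) * (W * τ j) := by
      rw [mul_assoc, ← mul_assoc (W : L) (τ i), (hWD _ (hτD i)).eq, mul_assoc, mul_assoc,
        ← mul_assoc (W : L) (τ i)]
      rw [(hWD _ (hτD i)).eq, mul_assoc]
    rw [h1, hWτ, hWτ, smul_mul_smul_comm, hprod _ (Fin.succ_ne_zero j).symm, mul_smul_comm,
      smul_smul, smul_smul]
  -- The Clifford relations are checked after multiplication by W², where no inverses occur.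
  have hcancel : ∀ a b : L, (W : L) * W * a = W * W * b → a = b := fun a b h => by
    rwa [← Units.val_mul, Units.mul_right_inj] at h
  let f : RingQuot (CliffordRel s m) →ₐ[k] D :=
    RingQuot.liftAlgHom k ⟨FreeAlgebra.lift k fun i => ⟨τ i, hτD i⟩, by
      rintro _ _ (⟨i, j, hij⟩ | ⟨i⟩)
      · simp only [map_mul, map_smul, FreeAlgebra.lift_ι_apply]
        refine Subtype.ext (hcancel _ _ ?_)
        simp only [Subalgebra.coe_mul, Subalgebra.coe_smul, mul_smul_comm, hττ]
        rw [hy i.succ j.succ (by simpa using hij), smul_mul_assoc, smul_smul, smul_smul]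
        congr 1
        rw [← hs i j hij]
        linear_combination (-(l i * l j * ε 0 j.succ * c⁻¹ * ε i.succ j.succ)) *
          hε.mul_self 0 i.succ
      · simp only [map_mul, map_one, FreeAlgebra.lift_ι_apply]
        refine Subtype.ext (hcancel _ _ ?_)
        simp only [Subalgebra.coe_mul, hττ, Subalgebra.coe_one, mul_one]
        rw [hsq, smul_mul_assoc, smul_smul, ← hl]
        have h1 : -ε 0 i.succ * c ^ 2 * -ε 0 i.succ * c⁻¹ * c⁻¹ = 1 := by
          field_simp
          linear_combination hε.mul_self 0 i.succ
        rw [h1, one_smul]⟩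
  have hf : ∀ i, (f (RingQuot.mkAlgHom k _ (FreeAlgebra.ι k i)) : L) = τ i := fun i => by
    have h : f (RingQuot.mkAlgHom k _ (FreeAlgebra.ι k i)) = ⟨τ i, hτD i⟩ :=
      (RingQuot.liftAlgHom_mkAlgHom_apply ..).trans (FreeAlgebra.lift_ι_apply ..)
    rw [h]
  have hinj : Function.Injective f := by
    have h := IsShift.apply_injective (ρ := (ρ.comp D.val).comp f) (span_cliffordRel s m)
      (γ := fun I => ∑ i ∈ I, (Pi.single i.succ 1 + Pi.single 0 1 : Fin (m + 1) → ZMod 2))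
      (fun I => IsShift.squarefreeMonomial (fun i => ?_) I)
      sum_single_succ_add_single_zero_injective
    · intro a b hab
      apply h
      simp only [AlgHom.comp_apply, hab]
    · have h1 : ρ (τ i) = (l i * c⁻¹) • (ρ (y i.succ) * ρ (y 0)) := by
        have h2 := congrArg ρ (hWτ i)
        rw [map_mul, hρW, smul_one_mul, map_smul ρ (l i) (y i.succ * y 0), map_mul] at h2
        rw [mul_comm, mul_smul, ← h2, smul_smul, inv_mul_cancel₀ hc, one_smul]
      rw [AlgHom.comp_apply, AlgHom.comp_apply, Subalgebra.val_apply, hf, h1]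
      exact ((hρ _).mul (hρ _)).smul (mul_ne_zero (hl0 i) (inv_ne_zero hc))
  -- Surjectivity: the image of f contains y_i y_0 / W, hence every y_i y_j / W, hence all quotients
  -- of degree two and then of even degree.
  have hbase : ∀ i, ∃ z, (W : L) * f z = y i * y 0 := by
    intro i
    induction i using Fin.cases with
    | zero =>
      refine ⟨c⁻¹ • 1, ?_⟩
      rw [map_smul, map_one, Subalgebra.coe_smul, Subalgebra.coe_one, mul_smul_comm, mul_one, hsq]
    | succ i =>
      refine ⟨(l i)⁻¹ • RingQuot.mkAlgHom k _ (FreeAlgebra.ι k i), ?_⟩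
      rw [map_smul, Subalgebra.coe_smul, mul_smul_comm, hf, hWτ, smul_smul,
        inv_mul_cancel₀ (hl0 i), one_smul]
  have hpair : ∀ i j, ∃ z, (W : L) * f z = y i * y j := by
    intro i j
    obtain ⟨z, hz⟩ := hbase i
    obtain ⟨z', hz'⟩ := hbase j
    by_cases hj : j = 0
    · subst hj; exact ⟨z, hz⟩
    -- From (y_i y_0)(y_j y_0) = -ε_0j y_i y_j ω and ω = c⁻¹ W, solved for y_i y_j using ε_0j² = 1.
    · refine ⟨(c * -ε 0 j) • (z * z'), ?_⟩
      have h1 := hprod i (Ne.symm hj)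
      rw [← hz, ← hz', mul_smul_comm] at h1
      apply (Units.mul_left_inj W).1
      have h2 : y i * y j * (W : L) = (c * -ε 0 j) • (W * f z * (W * f z')) := by
        rw [h1, smul_smul, smul_smul]
        have h3 : c * -ε 0 j * -ε 0 j * c⁻¹ = 1 := by
          field_simp
          linear_combination hε.mul_self 0 j
        rw [h3, one_smul]
      rw [h2, map_smul, map_mul, Subalgebra.coe_smul, Subalgebra.coe_mul, mul_smul_comm,
        smul_mul_assoc]
      simp only [mul_assoc, ← (hWD _ (f z').2).eq]
  have hquad : ∀ v ∈ QuadAlg.deg (quadPerp (relA ε)) 2, ∃ z, (W : L) * f z = ι v := by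
    intro v hv
    rw [QuadAlg.deg, pow_two, Submodule.span_mul_span] at hv
    induction hv using Submodule.span_induction with
    | mem v hv =>
      obtain ⟨_, ⟨i, rfl⟩, _, ⟨j, rfl⟩, rfl⟩ := hv
      dsimp only
      rw [map_mul]
      exact hpair i j
    | zero => exact ⟨0, by simp⟩
    | add a b _ _ ha hb =>
      obtain ⟨z, hz⟩ := ha
      obtain ⟨z', hz'⟩ := hb
      exact ⟨z + z', by rw [map_add, Subalgebra.coe_add, mul_add, hz, hz', map_add]⟩
    | smul r a _ ha =>
      obtain ⟨z, hz⟩ := ha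
      exact ⟨r • z, by rw [map_smul, Subalgebra.coe_smul, mul_smul_comm, hz, map_smul]⟩
  have heven : ∀ r, ∀ a ∈ QuadAlg.deg (quadPerp (relA ε)) (2 * r),
      ∃ z, (W : L) ^ r * f z = ι a := by
    intro r
    induction r with
    | zero =>
      intro a ha
      rw [QuadAlg.deg, mul_zero, pow_zero, Submodule.mem_one] at ha
      obtain ⟨t, rfl⟩ := ha
      exact ⟨algebraMap k _ t, by rw [pow_zero, one_mul, AlgHom.commutes, AlgHom.commutes]; rfl⟩
    | succ r ih =>
      intro a ha
      rw [QuadAlg.deg, mul_add, mul_one, pow_add] at ha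
      induction ha using Submodule.mul_induction_on' with
      | mem_mul_mem a ha b hb =>
        obtain ⟨z, hz⟩ := ih a ha
        obtain ⟨z', hz'⟩ := hquad b hb
        refine ⟨z * z', ?_⟩
        rw [map_mul, Subalgebra.coe_mul, map_mul, ← hz, ← hz', pow_succ, mul_assoc, mul_assoc,
          ← mul_assoc (W : L), (hWD _ (f z).2).eq, mul_assoc]
      | add a _ b _ ha hb =>
        obtain ⟨z, hz⟩ := ha
        obtain ⟨z', hz'⟩ := hb
        exact ⟨z + z', by rw [map_add, Subalgebra.coe_add, mul_add, hz, hz', map_add]⟩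
  refine ⟨(AlgEquiv.ofBijective f ⟨hinj, fun b => ?_⟩).symm⟩
  obtain ⟨r, a, ha, h⟩ := (hD b).1 b.2
  obtain ⟨z, hz⟩ := heven r a ha
  refine ⟨z, Subtype.ext ?_⟩
  rw [← h, ← Units.val_pow_eq_pow_val, Units.mul_right_inj] at hz
  exact hz

/-- If the degree zero part `D` of a localization of `A^!` is commutative, then the products
of signs along triples containing `0` are `-1`. -/
theorem ADual.sign_of_commute {m : ℕ} {ε : Fin (m + 1) → Fin (m + 1) → k} (hε : IsSignMatrix ε)
    {L : Type*} [Ring L] [Algebra k L] (ι : ADual ε →ₐ[k] L) (W : Lˣ) {c : k}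
    (hW : (W : L) = c • ι (ADual.x ε 0 * ADual.x ε 0)) (D : Subalgebra k L)
    (hD : ∀ b, b ∈ D ↔ ∃ r, ∃ a ∈ QuadAlg.deg (quadPerp (relA ε)) (2 * r), (W : L) ^ r * b = ι a)
    (ρ : L →ₐ[k] Module.End k ((Fin (m + 1) → ZMod 2) →₀ k))
    (hρ : ∀ i, IsShift (ρ (ι (ADual.x ε i))) (Pi.single i 1))
    (hcomm : ∀ a ∈ D, ∀ b ∈ D, a * b = b * a) {i j : Fin m} (hij : i ≠ j) :
    -(ε i.succ j.succ * ε 0 i.succ * ε 0 j.succ) = 1 := by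
  let y : Fin (m + 1) → L := fun i => ι (ADual.x ε i)
  have hy : ∀ i j, i ≠ j → y i * y j = (-ε i j) • (y j * y i) := fun i j h => by
    simp only [y, ← map_mul, ← map_smul, ADual.x_mul_x hε h]
  have hsq : ∀ i, y i * y i = y 0 * y 0 := fun i => by
    simp only [y, ← map_mul, ADual.x_mul_self hε i 0]
  have hWι := ADual.commute_map_of_eq_smul_sq hε ι hW
  let b : Fin m → L := fun i => ↑W⁻¹ * (y i.succ * y 0)
  have hWb : ∀ i, (W : L) * b i = y i.succ * y 0 := fun i => Units.mul_inv_cancel_left _ _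
  have hbD : ∀ i, b i ∈ D := fun i => (hD _).2
    ⟨1, _, ADual.x_mul_x_mem_deg_two i.succ 0, by rw [pow_one, hWb, map_mul]⟩
  have hbW : ∀ i, Commute (W : L) (b i) := fun i => by
    refine commute_of_pow_mul_eq (r := 1) ((pow_one (W : L)).symm ▸ hWb i) ?_
    rw [← map_mul]
    exact hWι _
  have hyy : ∀ i j, y i.succ * y 0 * (y j.succ * y 0) = W * (W * (b i * b j)) := fun i j => by
    rw [← hWb, ← hWb, mul_assoc, ← mul_assoc (b i), ← (hbW i).eq, mul_assoc]
  -- Commutativity of b_i and b_j yields two scalar multiples of the single monomial y_j y_i y_0²,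
  -- which is nonzero because it acts as a shift; the scalars must agree.
  have h1 := hyy i j
  rw [hcomm _ (hbD i) _ (hbD j), ← hyy, mul_base_mul_mul_base hy hsq _ (Fin.succ_ne_zero _).symm,
    mul_base_mul_mul_base hy hsq _ (Fin.succ_ne_zero _).symm, hy i.succ j.succ (by simpa using hij),
    smul_mul_assoc, smul_smul, ← sub_eq_zero, ← sub_smul] at h1
  have hne : y j.succ * y i.succ * (y 0 * y 0) ≠ 0 := by
    intro h0
    have h2 := (((hρ j.succ).mul (hρ i.succ)).mul ((hρ 0).mul (hρ 0))).ne_zero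
    apply h2
    rw [← map_mul ρ, ← map_mul ρ, ← map_mul ρ]
    exact (congrArg ρ h0).trans (map_zero ρ)
  have h3 : -ε 0 j.succ * -ε i.succ j.succ - -ε 0 i.succ = 0 := by
    by_contra h
    exact hne ((IsUnit.mk0 _ h).smul_left_cancel.1 (h1.trans (smul_zero _).symm))
  linear_combination (-ε 0 i.succ) * h3 + hε.mul_self 0 i.succ

end Clifford

/-! ### Transfer to the Ore localization -/

section Localization

variable {k : Type u} [Field k]

-- Clearing denominators: after this only the unit W and equations W^r b = a are needed, not the Ore
-- construction.
open OreLocalization in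
theorem mem_locDegZero_iff {B : Type u} [Ring B] [Algebra k B] (V : Submodule k B)
    (w : Subalgebra.center k B) (hw : (w : B) ∈ V ^ 2)
    (b : OreLocalization (Submonoid.powers (w : B)) B) :
    b ∈ locDegZero V w hw ↔ ∃ r, ∃ a ∈ V ^ (2 * r),
      (numeratorRingHom (w : B) : OreLocalization (Submonoid.powers (w : B)) B) ^ r * b =
        numeratorRingHom a := by
  have key : ∀ r a, (numeratorRingHom (w : B) : OreLocalization (Submonoid.powers (w : B)) B) ^ r *
      (a /ₒ powElt w r) = numeratorRingHom a := fun r a => by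
    rw [← map_pow]
    exact OreLocalization.mul_cancel (s := powElt w r)
  constructor
  · rintro ⟨r, a, ha, rfl⟩
    exact ⟨r, a, ha, key r a⟩
  · rintro ⟨r, a, ha, h⟩
    have hu : IsUnit (numeratorRingHom (w : B) :
        OreLocalization (Submonoid.powers (w : B)) B) :=
      numerator_isUnit (⟨(w : B), Submonoid.mem_powers _⟩ : Submonoid.powers (w : B))
    exact ⟨r, a, ha, (hu.pow r).mul_left_cancel (h.trans (key r a).symm)⟩

-- Over Γ = (ℤ/2)^n doubling a shift gives 0, so ω acts as the identity and w as the nonzero scalar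
-- c. Powers of w are thus invertible and the representation extends.
open OreLocalization in
theorem exists_localizationRep [CharZero k] {n : ℕ} {ε : Fin n → Fin n → k}
    (hε : IsSignMatrix ε) (i₀ : Fin n) (w : Subalgebra.center k (ADual ε)) {c : k} (hc : c ≠ 0)
    (hw : (w : ADual ε) = c • (ADual.x ε i₀ * ADual.x ε i₀)) :
    ∃ ρ : OreLocalization (Submonoid.powers (w : ADual ε)) (ADual ε) →ₐ[k]
        Module.End k ((Fin n → ZMod 2) →₀ k),
      (∀ i, IsShift (ρ (numeratorRingHom (ADual.x ε i))) (Pi.single i 1)) ∧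
      ρ (numeratorRingHom (w : ADual ε)) = c • 1 := by
  obtain ⟨ρ, h1, h2⟩ := ADual.exists_shiftRep hε (AddMonoidHom.id (Fin n → ZMod 2))
    (fun i => Pi.single i 1) 0 (fun _ => rfl)
    (fun i => funext fun j => CharTwo.add_self_eq_zero _)
  have hρw : ρ w = c • 1 := by
    rw [hw, map_smul, h2]
    congr 1
    refine Finsupp.lhom_ext fun g r => ?_
    simp
  have hunit : ∀ s : Submonoid.powers (w : ADual ε),
      IsUnit (((ρ : ADual ε →* Module.End k ((Fin n → ZMod 2) →₀ k)).comp (Submonoid.powers (w : ADual ε)).subtype) s) := by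
    rintro ⟨_, r, rfl⟩
    have h3 : ρ ((w : ADual ε) ^ r) = algebraMap k _ (c ^ r) := by
      rw [map_pow, hρw, Algebra.algebraMap_eq_smul_one, smul_pow, one_pow]
    have h4 : IsUnit (ρ ((w : ADual ε) ^ r)) := by
      rw [h3]
      exact (IsUnit.mk0 _ (pow_ne_zero r hc)).map _
    exact h4
  let ψ := universalHom (S := Submonoid.powers (w : ADual ε)) ρ.toRingHom
    (IsUnit.liftRight _ hunit) (fun s => (IsUnit.coe_liftRight _ hunit s).symm)
  have hψ : ∀ a, ψ (numeratorRingHom a) = ρ a := fun a => universalHom_commutes _ _ _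
  refine ⟨{ ψ with commutes' := fun r => (hψ _).trans (ρ.commutes r) }, fun i => ?_, ?_⟩
  · exact (hψ (ADual.x ε i)).symm ▸ h1 i
  · exact (hψ w).trans hρw

/-- `A^! → A^![w⁻¹]`. -/
def ADual.toLocalization {n : ℕ} {ε : Fin n → Fin n → k} (w : Subalgebra.center k (ADual ε)) :
    ADual ε →ₐ[k] OreLocalization (Submonoid.powers (w : ADual ε)) (ADual ε) :=
  { OreLocalization.numeratorRingHom with commutes' := fun _ => rfl }

open OreLocalization in
theorem exists_unit_localization [CharZero k] {n : ℕ} {ε : Fin n → Fin n → k}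
    (hε : IsSignMatrix ε) (i₀ : Fin n) {w : Subalgebra.center k (ADual ε)}
    (hw : IsHypersurfaceElement ε w) :
    ∃ (W : (OreLocalization (Submonoid.powers (w : ADual ε)) (ADual ε))ˣ) (c : k)
      (ρ : OreLocalization (Submonoid.powers (w : ADual ε)) (ADual ε) →ₐ[k]
        Module.End k ((Fin n → ZMod 2) →₀ k)),
      c ≠ 0 ∧ W.val = c • ADual.toLocalization w (ADual.x ε i₀ * ADual.x ε i₀) ∧
      (∀ b, b ∈ locDegZero (Submodule.span k (Set.range (QuadAlg.gen (quadPerp (relA ε)))))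
        w hw.mem_deg ↔ ∃ r, ∃ a ∈ QuadAlg.deg (quadPerp (relA ε)) (2 * r),
          W.val ^ r * b = ADual.toLocalization w a) ∧
      (∀ i, IsShift (ρ (ADual.toLocalization w (ADual.x ε i))) (Pi.single i 1)) ∧
      ρ W.val = c • 1 := by
  obtain ⟨c, hc, h⟩ := hw.exists_eq_smul_sq hε i₀
  obtain ⟨ρ, h1, h2⟩ := exists_localizationRep hε i₀ w hc h
  have hu : IsUnit (numeratorRingHom (w : ADual ε) :
      OreLocalization (Submonoid.powers (w : ADual ε)) (ADual ε)) :=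
    numerator_isUnit (⟨(w : ADual ε), Submonoid.mem_powers _⟩ : Submonoid.powers (w : ADual ε))
  refine ⟨hu.unit, c, ρ, hc, ?_, fun b => mem_locDegZero_iff _ w hw.mem_deg b, h1, h2⟩
  rw [← map_smul, ← h]
  rfl

theorem CAlg.nonempty_equiv_clifford [CharZero k] [IsAlgClosed k] {m : ℕ}
    {ε : Fin (m + 1) → Fin (m + 1) → k} (hε : IsSignMatrix ε)
    (w : Subalgebra.center k (ADual ε)) (hw : IsHypersurfaceElement ε w) {s : k}
    (hs : ∀ i j : Fin m, i ≠ j → -(ε i.succ j.succ * ε 0 i.succ * ε 0 j.succ) = s) :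
    Nonempty (CAlg ε w hw ≃ₐ[k] RingQuot (CliffordRel s m)) := by
  obtain ⟨W, c, ρ, hc, hW, hD, hρ, hρW⟩ := exists_unit_localization hε 0 hw
  exact ADual.nonempty_equiv_clifford hε (ADual.toLocalization w) W hc hW _ hD ρ hρ hρW hs

theorem cliffordRel_one_mul_comm (m : ℕ) (a b : RingQuot (CliffordRel (1 : k) m)) :
    a * b = b * a := by
  have hgen : ∀ i j : Fin m, Commute
      (RingQuot.mkAlgHom k (CliffordRel (1 : k) m) (FreeAlgebra.ι k i))
      (RingQuot.mkAlgHom k (CliffordRel (1 : k) m) (FreeAlgebra.ι k j)) := by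
    intro i j
    by_cases h : i = j
    · rw [h]
    · rw [commute_iff_eq, ← map_mul, RingQuot.mkAlgHom_rel k (CliffordRel.swap i j h), one_smul,
        map_mul]
  have htop := adjoin_cliffordRel (1 : k) m
  refine Algebra.commute_of_mem_adjoin_of_forall_mem_commute (R := k) (s := Set.range fun i =>
    RingQuot.mkAlgHom k (CliffordRel (1 : k) m) (FreeAlgebra.ι k i))
    (htop ▸ Algebra.mem_top) ?_
  rintro _ ⟨i, rfl⟩
  refine (Algebra.commute_of_mem_adjoin_of_forall_mem_commute (R := k) (s := Set.range fun i =>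
    RingQuot.mkAlgHom k (CliffordRel (1 : k) m) (FreeAlgebra.ι k i))
    (htop ▸ Algebra.mem_top) ?_).symm
  rintro _ ⟨j, rfl⟩
  exact hgen i j

/-- Only the commutativity of C₋ is used. -/
theorem CAlg.sign_of_equiv_clifford_one [CharZero k] {m : ℕ}
    {ε : Fin (m + 1) → Fin (m + 1) → k} (hε : IsSignMatrix ε)
    (w : Subalgebra.center k (ADual ε)) (hw : IsHypersurfaceElement ε w)
    (e : CAlg ε w hw ≃ₐ[k] RingQuot (CliffordRel (1 : k) m)) {i j : Fin m} (hij : i ≠ j) :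
    -(ε i.succ j.succ * ε 0 i.succ * ε 0 j.succ) = 1 := by
  obtain ⟨W, c, ρ, -, hW, hD, hρ, -⟩ := exists_unit_localization hε 0 hw
  refine ADual.sign_of_commute
    (L := OreLocalization (Submonoid.powers (w : ADual ε)) (ADual ε)) hε (ADual.toLocalization w) W hW _ hD ρ hρ (fun a ha b hb => ?_) hij
  have h : (⟨a, ha⟩ : CAlg ε w hw) * ⟨b, hb⟩ = ⟨b, hb⟩ * ⟨a, ha⟩ := by
    apply e.injective
    rw [map_mul, map_mul, cliffordRel_one_mul_comm]
  exact congrArg Subtype.val h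

end Localization

/-! ### Triple products read off from E, and conversely -/

section PointScheme

variable {k : Type u} [Field k] {n : ℕ} {ε : Fin n → Fin n → k}

theorem Projectivization.rep_mk_apply_ne_zero_iff {v : Fin n → k} (hv : v ≠ 0) (i : Fin n) :
    (Projectivization.mk k v hv).rep i ≠ 0 ↔ v i ≠ 0 := by
  obtain ⟨a, ha⟩ := Projectivization.exists_smul_eq_mk_rep k v hv
  rw [← ha, Pi.smul_apply, Units.smul_def, smul_eq_mul]
  simp

/-- The point (1 : ⋯ : 1) has full support, so it tests every triple at once. -/
theorem sign_mul_of_pointScheme_eq_univ (hE : pointScheme (relS ε) = Set.univ)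
    (i j l : Fin n) : ε i j * ε j l * ε l i = 1 := by
  have hv : (fun _ : Fin n => (1 : k)) ≠ 0 := fun h => one_ne_zero (congrFun h i)
  have h1 := fun a => (Projectivization.rep_mk_apply_ne_zero_iff hv a).2 one_ne_zero
  exact sign_mul_sign_mul_sign_of_mem_pointScheme (hE ▸ Set.mem_univ _) (h1 i) (h1 j) (h1 l)

theorem mem_iUnion_linSubspace {p : ℙ k (Fin n → k)} :
    p ∈ (⋃ (i : Fin n) (j : Fin n) (_ : i < j), linSubspace k {i, j}) ↔
      ∃ i j, i < j ∧ ∀ l, p.rep l ≠ 0 → l = i ∨ l = j := by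
  simp only [Set.mem_iUnion, linSubspace, Set.mem_ofPred_eq, Set.mem_insert_iff,
    Set.mem_singleton_iff, exists_prop]
  refine exists_congr fun i => exists_congr fun j => and_congr_right fun _ => forall_congr' fun l => ?_
  rw [not_imp_comm]

/-- If a triple product were 1, the point with coordinates 1 at i, j, l and 0 elsewhere would lie in
E but on none of the lines ℙ(a,b). -/
theorem sign_mul_of_pointScheme_eq_iUnion (hε : IsSignMatrix ε)
    (hE : pointScheme (relS ε) = ⋃ (i : Fin n) (j : Fin n) (_ : i < j), linSubspace k {i, j})
    {i j l : Fin n} (hij : i ≠ j) (hjl : j ≠ l) (hli : l ≠ i) : ε i j * ε j l * ε l i = -1 := by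
  by_contra hne
  have h1 : ε i j * ε j l * ε l i = 1 := by
    have h2 : (ε i j * ε j l * ε l i) * (ε i j * ε j l * ε l i) = 1 := by
      linear_combination (ε j l * ε l i) ^ 2 * hε.mul_self i j + (ε l i) ^ 2 * hε.mul_self j l +
        hε.mul_self l i
    exact (mul_self_eq_one_iff.1 h2).resolve_right hne
  have hjl' : ε j l = ε i j * ε i l := by
    rw [hε.symm i l]
    linear_combination (ε i j * ε l i) * h1 - ε j l * ε l i ^ 2 * hε.mul_self i j
      - ε j l * hε.mul_self l i
  let v : Fin n → k := fun a => if a = i ∨ a = j ∨ a = l then 1 else 0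
  have hv : v ≠ 0 := fun h => one_ne_zero (α := k) (by simpa [v] using congrFun h i)
  have hrep := Projectivization.rep_mk_apply_ne_zero_iff hv
  have hmem : ∀ a, (Projectivization.mk k v hv).rep a ≠ 0 ↔ a = i ∨ a = j ∨ a = l := fun a => by
    simp only [hrep, v, ne_eq, ite_eq_right_iff, one_ne_zero, imp_false, not_not]
  have hp : Projectivization.mk k v hv ∈ pointScheme (relS ε) := by
    -- With η = ε_i, the condition ε_ab = ε_ia ε_ib on {i, j, l} is exactly the assumed triple
    -- product.
    refine mem_pointScheme_of_sign_eq (ε i) (hε.mul_self i) fun a b ha hb => ?_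
    rw [hmem] at ha hb
    rcases ha with rfl | rfl | rfl <;> rcases hb with rfl | rfl | rfl <;>
      try simp only [hε.diag, hε.mul_self, one_mul, mul_one]
    · exact hε.symm _ _
    · exact hjl'
    · exact hε.symm _ _
    · rw [hε.symm, hjl', mul_comm]
  rw [hE, mem_iUnion_linSubspace] at hp
  obtain ⟨a, b, -, h⟩ := hp
  have hi := h i ((hmem i).2 (by simp))
  have hj := h j ((hmem j).2 (by simp))
  have hl := h l ((hmem l).2 (by simp))
  grind

theorem pointScheme_eq_iUnion [CharZero k] (hn : 2 ≤ n) (hε : IsSignMatrix ε)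
    (h : ∀ i j l : Fin n, i ≠ j → j ≠ l → l ≠ i → ε i j * ε j l * ε l i = -1) :
    pointScheme (relS ε) = ⋃ (i : Fin n) (j : Fin n) (_ : i < j), linSubspace k {i, j} := by
  classical
  ext p
  rw [mem_iUnion_linSubspace]
  constructor
  · intro hp
    have hcard : (Finset.univ.filter fun i => p.rep i ≠ 0).card ≤ 2 := by
      by_contra! hlt
      obtain ⟨a, b, c, ha, hb, hc, hab, hac, hbc⟩ := Finset.two_lt_card_iff.1 hlt
      simp only [Finset.mem_filter, Finset.mem_univ, true_and] at ha hb hc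
      have h1 := sign_mul_sign_mul_sign_of_mem_pointScheme hp ha hb hc
      rw [h a b c hab hbc hac.symm] at h1
      norm_num at h1
    -- A support with one element must be enlarged to a pair, which is where n ≥ 2 enters.
    obtain ⟨t, hst, ht⟩ := Finset.exists_superset_card_eq hcard (by simpa using hn)
    obtain ⟨a, b, hab, rfl⟩ := Finset.card_eq_two.1 ht
    have hsupp : ∀ l, p.rep l ≠ 0 → l = a ∨ l = b := fun l hl => by
      have := hst (Finset.mem_filter.2 ⟨Finset.mem_univ l, hl⟩)
      simpa using this
    rcases lt_or_gt_of_ne hab with h | h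
    · exact ⟨a, b, h, hsupp⟩
    · exact ⟨b, a, h, fun l hl => (hsupp l hl).symm⟩
  · rintro ⟨i, j, hij, hsupp⟩
    -- On two coordinates the sign ε_ij always splits as η_i η_j, here with η_i = 1 and η_j = ε_ij.
    refine mem_pointScheme_of_sign_eq (fun a => if a = j then ε i j else 1) (fun a => ?_)
      fun a b ha hb => ?_
    · split_ifs
      · exact hε.mul_self i j
      · exact one_mul 1
    · rcases hsupp a ha with rfl | rfl <;> rcases hsupp b hb with rfl | rfl <;>
        simp [hij.ne, hε.diag, hε.mul_self, hε.symm]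

end PointScheme

end

theorem proposition3p2 {k : Type u} [Field k] [IsAlgClosed k] [CharZero k] (n : ℕ) (hn : 1 ≤ n)
    (ε : Fin n → Fin n → k) (hε : IsSignMatrix ε) :
    (∃ w : Subalgebra.center k (ADual ε), IsHypersurfaceElement ε w) ∧
    ∀ (w : Subalgebra.center k (ADual ε)) (hw : IsHypersurfaceElement ε w),
      (pointScheme (relS ε) = Set.univ → Nonempty (CAlg ε w hw ≃ₐ[k] CPlus k n)) ∧
      (2 ≤ n →
        (pointScheme (relS ε) = ⋃ (i : Fin n) (j : Fin n) (_ : i < j), linSubspace k {i, j} ↔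
          Nonempty (CAlg ε w hw ≃ₐ[k] CMinus k n))) := by
  obtain ⟨m, rfl⟩ : ∃ m, n = m + 1 := ⟨n - 1, by omega⟩
  refine ⟨⟨_, isHypersurfaceElement_sq hε 0⟩, fun w hw => ⟨fun hE => ?_, fun h2 => ⟨fun hE => ?_,
    fun ⟨e⟩ => ?_⟩⟩⟩
  · refine CAlg.nonempty_equiv_clifford hε w hw (m := m) fun i j _ => ?_
    have h := sign_mul_of_pointScheme_eq_univ hE i.succ j.succ 0
    rw [hε.symm 0 j.succ]
    linear_combination -h
  · refine CAlg.nonempty_equiv_clifford hε w hw (m := m) fun i j hij => ?_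
    have h := sign_mul_of_pointScheme_eq_iUnion hε hE (i := i.succ) (j := j.succ) (l := 0)
      (by simpa using hij) (Fin.succ_ne_zero _) (Fin.succ_ne_zero _).symm
    rw [hε.symm 0 j.succ]
    linear_combination -h
  · have hs : ∀ i j : Fin m, i ≠ j → -(ε i.succ j.succ * ε 0 i.succ * ε 0 j.succ) = 1 :=
      fun i j hij => CAlg.sign_of_equiv_clifford_one hε w hw e hij
    refine pointScheme_eq_iUnion h2 hε fun i j l hij hjl hli => ?_
    induction i using Fin.cases with
    | zero =>
      obtain ⟨j, rfl⟩ := Fin.exists_succ_eq.2 hij.symm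
      obtain ⟨l, rfl⟩ := Fin.exists_succ_eq.2 hli
      rw [hε.symm l.succ 0]
      linear_combination -hs j l (by simpa using hjl)
    | succ i =>
      induction j using Fin.cases with
      | zero =>
        obtain ⟨l, rfl⟩ := Fin.exists_succ_eq.2 hjl.symm
        rw [hε.symm i.succ 0]
        linear_combination -hs l i (by simpa using hli)
      | succ j =>
        induction l using Fin.cases with
        | zero =>
          rw [hε.symm j.succ 0]
          linear_combination -hs i j (by simpa using hij)
        | succ l =>
          have h1 := hs i j (by simpa using hij)
          have h2 := hs j l (by simpa using hjl)
          have h3 := hs l i (by simpa using hli)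
          have e1 := hε.mul_self 0 i.succ
          have e2 := hε.mul_self 0 j.succ
          have e3 := hε.mul_self 0 l.succ
          -- Multiply the conditions for the triples (0,i,j), (0,j,l), (0,l,i): each ε_0a occurs
          -- twice, and three minus signs give -1.
          have h4 : (ε i.succ j.succ * ε j.succ l.succ * ε l.succ i.succ) *
              ((ε 0 i.succ * ε 0 i.succ) * (ε 0 j.succ * ε 0 j.succ) *
                (ε 0 l.succ * ε 0 l.succ)) = -1 := by
            have h5 := congrArg₂ (· * ·) (congrArg₂ (· * ·) h1 h2) h3
            linear_combination -h5
          rwa [e1, e2, e3, mul_one, mul_one, mul_one] at h4
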